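/- Let $d\ge 0$. A Poisson system is an ODE $y'=S(y)\nabla H(y)$ on $\mathbb R^d$ with $S:\mathbb R^d\to\mathbb R^{d\times d}$ skew-symmetric-matrix valued and $H:\mathbb R^d\to\mathbb R$. (The Jacobi identity is not required.) A 3-degree partitioned continuous-stage Runge–Kutta (PCSRK) method is given by matrices $M_1,M_2,M_3\in\mathbb R^{3\times 3}$ and nodes $0\le c_1<c_2<c_3\le 1$. Put $$A_{\tau,j,\zeta}=\begin{bmatrix}\tau&\tfrac{\tau^2}{2}&\tfrac{\tau^3}{3}\end{bmatrix}M_j\begin{bmatrix}1\\ \zeta\\ \zeta^2\end{bmatrix},\qquad B_{j,\zeta}=A_{1,j,\zeta}.$$ A step of size $h\in\mathbb R$ from $y_0$ to $y_1$ consists of a polynomial $Y_\tau$ in $\tau$ of degree at most $3$ with values in $\mathbb R^d$ and of vectors $Z_1,Z_2,Z_3,y_1\in\mathbb R^d$ such that, for $\tau\in[0,1]$ and $i=1,2,3$, $$Y_\tau=y_0+h\sum_{j=1}^3\int_0^1A_{\tau,j,\zeta}S(Z_j)\nabla H(Y_\zeta)\,d\zeta,\qquad Z_i=y_0+h\sum_{j=1}^3\int_0^1A_{c_i,j,\zeta}S(Z_j)\nabla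 H(Y_\zeta)\,d\zeta,$$ $$y_1=y_0+h\sum_{i=1}^3\int_0^1B_{i,\tau}S(Z_i)\nabla H(Y_\tau)\,d\tau .$$ Assume that 1. $M_i=M_i^{\mathsf T}$ for $i=1,2,3$; 2. for some $\alpha\in\mathbb R$, $\begin{bmatrix}1&1/2&1/3\\1/2&1/3&1/4\\1/3&1/4&\alpha\end{bmatrix}(M_1+M_2+M_3)=I_3$; 3. $\begin{bmatrix}1&1&1\\0&-1&-2\\0&0&1\end{bmatrix}M_3\begin{bmatrix}1&0&0\\1&-1&0\\1&-2&1\end{bmatrix}=M_1$; 4. $c_1+c_3=1$ and $c_2=\tfrac12$; 5. $(c_1M_1+c_2M_2+c_3M_3)\,[1,\tfrac12,\tfrac13]^{\mathsf T}=[0,1,0]^{\mathsf T}$; 6. $[1,\tfrac12,\tfrac13]\,(c_1^2M_1+c_2^2M_2+c_3^2M_3)\,[1,\tfrac12,\tfrac13]^{\mathsf T}=\tfrac13$. Then the method, applied to Poisson systems, is - energy-preserving: if $S$ is continuous and $H$ is $C^1$, then $H(y_1)=H(y_0)$ for every step from $y_0$ to $y_1$ of any size $h$; - symmetric: if $S$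 is continuous and $H$ is $C^1$, then there is a step of size $h$ from $y_0$ to $y_1$ if and only if there is a step of size $-h$ from $y_1$ to $y_0$; - of order at least 4: if $S$ is $C^4$ and $H$ is $C^5$, then for every $y_0\in\mathbb R^d$ and every solution $y$ of the system near $t=0$ with $y(0)=y_0$ there are $r,h_0>0$ and $C$ such that for all $|h|\le h_0$ there is exactly one step of size $h$ from $y_0$ with $|Y_\tau-y_0|\le r$ on $[0,1]$, and its result satisfies $|y_1-y(h)|\le C|h|^5$. -/

import Mathlib

open scoped Matrix Gradient Topology

noncomputable section

/-- The data of a system `y' = S(y) ∇H(y)` on `ℝ^d`: `S` is a skew-symmetric matrix function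
of class `C^k` (entrywise) and the energy `H` is of class `C^(k+1)`. -/
structure IsPoissonSystem {d : ℕ} (k : ℕ)
    (S : EuclideanSpace ℝ (Fin d) → Matrix (Fin d) (Fin d) ℝ)
    (H : EuclideanSpace ℝ (Fin d) → ℝ) : Prop where
  skew : ∀ y, (S y)ᵀ = -S y
  contDiff_S : ∀ i j, ContDiff ℝ k (fun y => S y i j)
  contDiff_H : ContDiff ℝ (k + 1) H

/-- The vector `S(z) ∇H(y)`. -/
def poissonField {d : ℕ} (S : EuclideanSpace ℝ (Fin d) → Matrix (Fin d) (Fin d) ℝ)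
    (H : EuclideanSpace ℝ (Fin d) → ℝ) (z y : EuclideanSpace ℝ (Fin d)) :
    EuclideanSpace ℝ (Fin d) :=
  Matrix.toEuclideanLin (S z) (∇ H y)

/-- An `s`-degree partitioned continuous-stage Runge–Kutta method, given by its coefficient
matrices `M_1, …, M_s` and its nodes `0 ≤ c_1 < ⋯ < c_s ≤ 1` (indexed from `0` here). -/
structure PCSRK (s : ℕ) where
  M : Fin s → Matrix (Fin s) (Fin s) ℝ
  c : Fin s → ℝ
  c_strictMono : StrictMono c
  c_mem : ∀ i, c i ∈ Set.Icc (0 : ℝ) 1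

namespace PCSRK

variable {s : ℕ}

/-- `A_{τ,j,ζ} = [τ, τ²/2, …, τ^s/s] M_j [1, ζ, …, ζ^(s-1)]ᵀ`. -/
def A (m : PCSRK s) (τ : ℝ) (j : Fin s) (ζ : ℝ) : ℝ :=
  (fun k : Fin s => τ ^ ((k : ℕ) + 1) / (((k : ℕ) : ℝ) + 1)) ⬝ᵥ
    (m.M j *ᵥ fun l : Fin s => ζ ^ (l : ℕ))

/-- `B_{j,ζ} = A_{1,j,ζ}`. -/
def B (m : PCSRK s) (j : Fin s) (ζ : ℝ) : ℝ := m.A 1 j ζ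

/-- The defining equations of one step of size `h` from `y₀` to `y₁`, with the polynomial
`Y_τ` of degree at most `s` and the internal stages `Z_1, …, Z_s`. -/
structure IsStep (m : PCSRK s) {d : ℕ}
    (S : EuclideanSpace ℝ (Fin d) → Matrix (Fin d) (Fin d) ℝ)
    (H : EuclideanSpace ℝ (Fin d) → ℝ) (h : ℝ) (y₀ : EuclideanSpace ℝ (Fin d))
    (Y : ℝ → EuclideanSpace ℝ (Fin d)) (Z : Fin s → EuclideanSpace ℝ (Fin d))
    (y₁ : EuclideanSpace ℝ (Fin d)) : Prop where
  isPolynomial : ∃ a : Fin (s + 1) → EuclideanSpace ℝ (Fin d),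
    ∀ τ, Y τ = ∑ k : Fin (s + 1), τ ^ (k : ℕ) • a k
  stage_Y : ∀ τ ∈ Set.Icc (0 : ℝ) 1,
    Y τ = y₀ + h • ∑ j, ∫ ζ in (0 : ℝ)..1, m.A τ j ζ • poissonField S H (Z j) (Y ζ)
  stage_Z : ∀ i,
    Z i = y₀ + h • ∑ j, ∫ ζ in (0 : ℝ)..1, m.A (m.c i) j ζ • poissonField S H (Z j) (Y ζ)
  output : y₁ = y₀ + h • ∑ i, ∫ τ in (0 : ℝ)..1, m.B i τ • poissonField S H (Z i) (Y τ)

/-- The method, applied to any Poisson system, preserves the energy in every step. -/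
def EnergyPreserving (m : PCSRK s) : Prop :=
  ∀ (d : ℕ) (S : EuclideanSpace ℝ (Fin d) → Matrix (Fin d) (Fin d) ℝ)
    (H : EuclideanSpace ℝ (Fin d) → ℝ), IsPoissonSystem 0 S H →
    ∀ (h : ℝ) (y₀ y₁ : EuclideanSpace ℝ (Fin d)) (Y : ℝ → EuclideanSpace ℝ (Fin d))
      (Z : Fin s → EuclideanSpace ℝ (Fin d)),
      m.IsStep S H h y₀ Y Z y₁ → H y₁ = H y₀

/-- The method is symmetric: exchanging `y₀ ↔ y₁` and `h ↔ -h` leaves it unaltered, for every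
Poisson system. -/
def Symmetric (m : PCSRK s) : Prop :=
  ∀ (d : ℕ) (S : EuclideanSpace ℝ (Fin d) → Matrix (Fin d) (Fin d) ℝ)
    (H : EuclideanSpace ℝ (Fin d) → ℝ), IsPoissonSystem 0 S H →
    ∀ (h : ℝ) (y₀ y₁ : EuclideanSpace ℝ (Fin d)),
      (∃ Y Z, m.IsStep S H h y₀ Y Z y₁) ↔ (∃ Y Z, m.IsStep S H (-h) y₁ Y Z y₀)

/-- The method has order at least `p` for Poisson systems: for every Poisson system with `S` of
class `C^p` and `H` of class `C^(p+1)`, every `y₀` and every solution `y` of the system near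
`t = 0` with `y(0) = y₀`, the method has, for all small `|h|`, exactly one step whose stages stay
in a fixed neighbourhood of `y₀` (the equations are implicit and may also have spurious far
solutions), and the local error `y₁ - y(h)` of this step is `O(|h|^(p+1))`. -/
def HasOrderAtLeast (m : PCSRK s) (p : ℕ) : Prop :=
  ∀ (d : ℕ) (S : EuclideanSpace ℝ (Fin d) → Matrix (Fin d) (Fin d) ℝ)
    (H : EuclideanSpace ℝ (Fin d) → ℝ), IsPoissonSystem p S H →
    ∀ (y₀ : EuclideanSpace ℝ (Fin d)) (y : ℝ → EuclideanSpace ℝ (Fin d)), y 0 = y₀ →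
      (∀ᶠ t in 𝓝 (0 : ℝ), HasDerivAt y (poissonField S H (y t) (y t)) t) →
      ∃ r > (0 : ℝ), ∃ h₀ > (0 : ℝ), ∃ C : ℝ, ∀ h : ℝ, |h| ≤ h₀ →
        (∃! q : (ℝ → EuclideanSpace ℝ (Fin d)) × (Fin s → EuclideanSpace ℝ (Fin d)) ×
            EuclideanSpace ℝ (Fin d),
          m.IsStep S H h y₀ q.1 q.2.1 q.2.2 ∧ ∀ τ ∈ Set.Icc (0 : ℝ) 1, ‖q.1 τ - y₀‖ ≤ r) ∧
        ∀ (Y : ℝ → EuclideanSpace ℝ (Fin d)) (Z : Fin s → EuclideanSpace ℝ (Fin d))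
          (y₁ : EuclideanSpace ℝ (Fin d)), m.IsStep S H h y₀ Y Z y₁ →
          (∀ τ ∈ Set.Icc (0 : ℝ) 1, ‖Y τ - y₀‖ ≤ r) → ‖y₁ - y h‖ ≤ C * |h| ^ (p + 1)

end PCSRK

end

/-! A step is determined by the coefficients `v` of the derivative `h ∑ τ^k v_k` of `Y`: `Z_i =
Y_{c_i}`, `y₁ = Y_1`, and `v` solves a fixed-point equation (`isStep_iff`).

Energy: `H(y₁) - H(y₀) = ∫ ⟨∇H(Y), Y'⟩ = h ∑_j ∑_{k,l} (M_j)_{kl} ⟨N_k, S(Z_j) N_l⟩` with `N_l = ∫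
τ^l ∇H(Y_τ) dτ`. Each inner double sum pairs a symmetric matrix with a skew form, so it vanishes.

Symmetry: write `K_j(τ, ζ)` for the `τ`-derivative of `A_{τ,j,ζ}`. The hypotheses say that `(τ, ζ) ↦
(1 - τ, 1 - ζ)` exchanges `K_j` and `K_{rev j}`, so the path `Y_{1-τ}` solves the equations for
`-h`.

Order: let `f(x) = S(x)∇H(x)` and let `D(τ) = ∑ τ^k v_k - f(Y_τ)` be the defect. If `S(Y_τ)` and
`∇H(Y_τ)` are expanded in powers of `τ`, with `k`-th coefficient `O(h^k)`, then `D` is, up to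
`O(h⁴)`, a combination of the polynomials `defectPoly (b, c)` with coefficients `O(h^(b+c))`. These
vanish for `b + c ≤ 1`, have mean zero for `b + c ≤ 3`, and are orthogonal to `τ` for `b + c ≤ 2`
(`orderFourConditions`). Hence `D = O(h²)`, `∫ D = O(h⁴)`, `∫ (1 - τ) D = O(h³)`
(`unifBigO_defect`). The error `e(τ) = Y_τ - y(hτ)` satisfies `e' = h (D + f(Y) - f(y))`. This gives
`e = O(h³)`, then `∫ e = ∫ (1 - τ) e' = O(h⁴)`, and finally, linearising `f` at `y₀`, `e(1) = h (∫ D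
+ f'(y₀) ∫ e + O(h⁴)) = O(h⁵)` (`unifBigO_localError`). Existence and local uniqueness of the step
come from a contraction in `v` (`existsUnique_isStageSolution`). -/

section Poisson

/-! ### Regularity and skew-symmetry of Poisson systems. -/

variable {d : ℕ} {S : EuclideanSpace ℝ (Fin d) → Matrix (Fin d) (Fin d) ℝ}
  {H : EuclideanSpace ℝ (Fin d) → ℝ} {k : ℕ}

theorem contDiff_gradient_of_succ {H : EuclideanSpace ℝ (Fin d) → ℝ} (hH : ContDiff ℝ (k + 1) H) :
    ContDiff ℝ k (∇ H) := by
  have h1 : ContDiff ℝ k (fderiv ℝ H) := hH.fderiv_right le_rfl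
  exact ((InnerProductSpace.toDual ℝ (EuclideanSpace ℝ (Fin d))).symm.contDiff).comp h1

theorem IsPoissonSystem.contDiff_gradient (hP : IsPoissonSystem k S H) : ContDiff ℝ k (∇ H) :=
  contDiff_gradient_of_succ hP.contDiff_H

theorem IsPoissonSystem.hasGradientAt (hP : IsPoissonSystem k S H)
    (y : EuclideanSpace ℝ (Fin d)) : HasGradientAt H (∇ H y) y :=
  ((hP.contDiff_H.differentiable (by simp)) y).hasGradientAt

theorem IsPoissonSystem.continuous_poissonField (hP : IsPoissonSystem k S H)
    (z : EuclideanSpace ℝ (Fin d)) {Y : ℝ → EuclideanSpace ℝ (Fin d)} (hY : Continuous Y) :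
    Continuous fun ζ => poissonField S H z (Y ζ) :=
  (LinearMap.continuous_of_finiteDimensional _).comp (hP.contDiff_gradient.continuous.comp hY)

theorem IsPoissonSystem.inner_skew (hP : IsPoissonSystem k S H)
    (z u w : EuclideanSpace ℝ (Fin d)) :
    inner ℝ u (Matrix.toEuclideanLin (S z) w) = - inner ℝ w (Matrix.toEuclideanLin (S z) u) := by
  have key : ∀ u w : EuclideanSpace ℝ (Fin d),
      inner ℝ u (Matrix.toEuclideanLin (S z) w) = u.ofLp ⬝ᵥ S z *ᵥ w.ofLp :=
    fun u w => Matrix.inner_toEuclideanCLM (S z) u w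
  rw [key, key, Matrix.dotProduct_mulVec, ← Matrix.mulVec_transpose, hP.skew z, dotProduct_comm,
    Matrix.neg_mulVec, dotProduct_neg]

end Poisson

/-! ### The stage polynomial and its coefficients. -/

namespace PCSRK

variable {s : ℕ} {E : Type*} [NormedAddCommGroup E] [NormedSpace ℝ E]

/-- The vectors `∑ j, ∑ l, (M_j)_{kl} ∫ ζ^l g_j(ζ) dζ`. -/
noncomputable def stageCoeff (m : PCSRK s) (g : Fin s → ℝ → E) (k : Fin s) : E :=
  ∑ j, ∑ l : Fin s, m.M j k l • ∫ ζ in (0 : ℝ)..1, ζ ^ (l : ℕ) • g j ζ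

/-- The polynomial with value `y₀` at `0` and derivative `h ∑ k, τ^k v_k`. -/
noncomputable def stagePoly (y₀ : E) (h : ℝ) (v : Fin s → E) (τ : ℝ) : E :=
  y₀ + h • ∑ k : Fin s, (τ ^ ((k : ℕ) + 1) / (((k : ℕ) : ℝ) + 1)) • v k

theorem A_eq_sum (m : PCSRK s) (τ : ℝ) (j : Fin s) (ζ : ℝ) :
    m.A τ j ζ = ∑ k : Fin s, ∑ l : Fin s,
      τ ^ ((k : ℕ) + 1) / (((k : ℕ) : ℝ) + 1) * m.M j k l * ζ ^ (l : ℕ) := by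
  simp only [A, dotProduct, Matrix.mulVec, Finset.mul_sum, mul_assoc]

theorem sum_integral_A (m : PCSRK s) (τ : ℝ) {g : Fin s → ℝ → E} (hg : ∀ j, Continuous (g j)) :
    ∑ j, ∫ ζ in (0 : ℝ)..1, m.A τ j ζ • g j ζ =
      ∑ k : Fin s, (τ ^ ((k : ℕ) + 1) / (((k : ℕ) : ℝ) + 1)) • m.stageCoeff g k := by
  have h1 : ∀ j, ∫ ζ in (0 : ℝ)..1, m.A τ j ζ • g j ζ =
      ∑ k : Fin s, ∑ l : Fin s, (τ ^ ((k : ℕ) + 1) / (((k : ℕ) : ℝ) + 1)) • m.M j k l •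
        ∫ ζ in (0 : ℝ)..1, ζ ^ (l : ℕ) • g j ζ := by
    intro j
    have hi : ∀ l : Fin s, Continuous fun ζ : ℝ => ζ ^ (l : ℕ) • g j ζ :=
      fun l => (continuous_id.pow _).smul (hg j)
    simp_rw [A_eq_sum, Finset.sum_smul, mul_smul]
    rw [intervalIntegral.integral_finsetSum]
    · refine Finset.sum_congr rfl fun k _ => ?_
      rw [intervalIntegral.integral_finsetSum]
      · refine Finset.sum_congr rfl fun l _ => ?_
        rw [intervalIntegral.integral_smul, intervalIntegral.integral_smul]
      · intro l _
        exact (((hi l).const_smul _).const_smul _).intervalIntegrable _ _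
    · intro k _
      refine Continuous.intervalIntegrable ?_ _ _
      exact continuous_finsetSum _ fun l _ => ((hi l).const_smul _).const_smul _
  simp_rw [h1]
  rw [Finset.sum_comm]
  refine Finset.sum_congr rfl fun k _ => ?_
  simp only [stageCoeff, Finset.smul_sum]

theorem stagePoly_zero (y₀ : E) (h : ℝ) (v : Fin s → E) : stagePoly y₀ h v 0 = y₀ := by
  simp [stagePoly]

theorem hasDerivAt_stagePoly (y₀ : E) (h : ℝ) (v : Fin s → E) (τ : ℝ) :
    HasDerivAt (stagePoly y₀ h v) (h • ∑ k : Fin s, τ ^ (k : ℕ) • v k) τ := by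
  refine HasDerivAt.const_add _ (HasDerivAt.const_smul _ (HasDerivAt.fun_sum fun k _ => ?_))
  refine HasDerivAt.smul_const ?_ _
  have h2 := (hasDerivAt_pow ((k : ℕ) + 1) τ).div_const (((k : ℕ) : ℝ) + 1)
  refine h2.congr_deriv ?_
  have : ((k : ℕ) : ℝ) + 1 ≠ 0 := by positivity
  rw [Nat.add_sub_cancel, Nat.cast_add_one]
  field_simp

theorem continuous_stagePoly (y₀ : E) (h : ℝ) (v : Fin s → E) : Continuous (stagePoly y₀ h v) :=
  continuous_iff_continuousAt.2 fun τ => (hasDerivAt_stagePoly y₀ h v τ).continuousAt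

theorem stagePoly_eq_sum (y₀ : E) (h : ℝ) (v : Fin s → E) :
    ∃ a : Fin (s + 1) → E, ∀ τ, stagePoly y₀ h v τ = ∑ k : Fin (s + 1), τ ^ (k : ℕ) • a k := by
  refine ⟨Fin.cons y₀ fun k => (h / (((k : ℕ) : ℝ) + 1)) • v k, fun τ => ?_⟩
  rw [Fin.sum_univ_succ]
  simp only [stagePoly, Fin.val_zero, pow_zero, Fin.cons_zero, one_smul, Fin.val_succ,
    Fin.cons_succ, Finset.smul_sum, smul_smul]
  congr 1
  refine Finset.sum_congr rfl fun k _ => ?_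
  congr 1
  ring

end PCSRK

/-- The stage equations constrain `Y` on `[0, 1]` only, while steps are compared as functions on all
of `ℝ`; each coordinate is a polynomial, and agreement at infinitely many points suffices. -/
theorem eq_of_eqOn_Icc_of_eq_sum_pow {d n : ℕ} {Y Y' : ℝ → EuclideanSpace ℝ (Fin d)}
    (hY : ∃ a : Fin n → EuclideanSpace ℝ (Fin d), ∀ τ, Y τ = ∑ k : Fin n, τ ^ (k : ℕ) • a k)
    (hY' : ∃ a : Fin n → EuclideanSpace ℝ (Fin d), ∀ τ, Y' τ = ∑ k : Fin n, τ ^ (k : ℕ) • a k)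
    (h : ∀ τ ∈ Set.Icc (0 : ℝ) 1, Y τ = Y' τ) : Y = Y' := by
  obtain ⟨a, ha⟩ := hY
  obtain ⟨b, hb⟩ := hY'
  have ev : ∀ (a : Fin n → EuclideanSpace ℝ (Fin d)) (i : Fin d) (τ : ℝ),
      (∑ k : Fin n, Polynomial.C (a k i) * Polynomial.X ^ (k : ℕ)).eval τ =
        (∑ k : Fin n, τ ^ (k : ℕ) • a k) i := by
    intro a i τ
    rw [Polynomial.eval_finsetSum, WithLp.ofLp_sum, Finset.sum_apply]
    refine Finset.sum_congr rfl fun k _ => ?_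
    rw [Polynomial.eval_C_mul, Polynomial.eval_pow, Polynomial.eval_X, PiLp.smul_apply,
      smul_eq_mul, mul_comm]
  funext τ
  ext i
  rw [ha, hb, ← ev, ← ev]
  congr 1
  refine Polynomial.eq_of_infinite_eval_eq _ _
    ((Set.Icc_infinite (zero_lt_one' ℝ)).mono fun t ht => ?_)
  change Polynomial.eval t _ = Polynomial.eval t _
  rw [ev, ev, ← ha, ← hb, h t ht]

/-! ### Steps as fixed points; energy preservation and symmetry. -/

namespace PCSRK

variable {s : ℕ} {d : ℕ} {S : EuclideanSpace ℝ (Fin d) → Matrix (Fin d) (Fin d) ℝ}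
  {H : EuclideanSpace ℝ (Fin d) → ℝ}

theorem IsStep.continuous {m : PCSRK s} {h : ℝ} {y₀ y₁ : EuclideanSpace ℝ (Fin d)}
    {Y : ℝ → EuclideanSpace ℝ (Fin d)} {Z : Fin s → EuclideanSpace ℝ (Fin d)}
    (hs : m.IsStep S H h y₀ Y Z y₁) : Continuous Y := by
  obtain ⟨a, ha⟩ := hs.isPolynomial
  rw [funext ha]
  fun_prop

/-- A step is a fixed point of a map on the coefficients of the polynomial `Y`. -/
theorem isStep_iff (m : PCSRK s) {k : ℕ} (hP : IsPoissonSystem k S H) {h : ℝ}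
    {y₀ y₁ : EuclideanSpace ℝ (Fin d)}
    {Y : ℝ → EuclideanSpace ℝ (Fin d)} {Z : Fin s → EuclideanSpace ℝ (Fin d)} :
    m.IsStep S H h y₀ Y Z y₁ ↔ ∃ v : Fin s → EuclideanSpace ℝ (Fin d),
      Y = stagePoly y₀ h v ∧ (∀ i, Z i = Y (m.c i)) ∧ y₁ = Y 1 ∧
      ∀ k, v k = m.stageCoeff (fun j ζ => poissonField S H (Y (m.c j)) (Y ζ)) k := by
  constructor
  · intro hs
    have hg := fun j => hP.continuous_poissonField (Z j) hs.continuous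
    have hY1 : ∀ τ ∈ Set.Icc (0 : ℝ) 1, Y τ = stagePoly y₀ h
        (m.stageCoeff fun j ζ => poissonField S H (Z j) (Y ζ)) τ := by
      intro τ hτ
      rw [hs.stage_Y τ hτ, m.sum_integral_A τ hg, stagePoly]
    have hY := eq_of_eqOn_Icc_of_eq_sum_pow hs.isPolynomial (stagePoly_eq_sum _ _ _) hY1
    have hZ : ∀ i, Z i = Y (m.c i) := fun i => by
      rw [hs.stage_Z i, hs.stage_Y _ (m.c_mem i)]
    refine ⟨_, hY, hZ, ?_, fun k => ?_⟩
    · rw [hs.output, hs.stage_Y 1 (by simp)]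
      rfl
    · simp_rw [hZ]
  · rintro ⟨v, hY, hZ, h1, hv⟩
    have hc : Continuous Y := hY ▸ continuous_stagePoly _ _ _
    have hg := fun j => hP.continuous_poissonField (Z j) hc
    have hv' : v = m.stageCoeff fun j ζ => poissonField S H (Z j) (Y ζ) := by
      funext k
      simp_rw [hv k, hZ]
    have hA : ∀ τ, Y τ = y₀ + h • ∑ j, ∫ ζ in (0 : ℝ)..1,
        m.A τ j ζ • poissonField S H (Z j) (Y ζ) := by
      intro τ
      rw [m.sum_integral_A τ hg, ← hv', congrFun hY τ, stagePoly]
    exact ⟨hY ▸ stagePoly_eq_sum _ _ _, fun τ _ => hA τ, fun i => by rw [hZ i, hA], by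
      rw [h1, hA]; rfl⟩

/-- Symmetric coefficient matrices give an energy-preserving method. -/
theorem energyPreserving_of_transpose_eq (m : PCSRK s) (hM : ∀ j, (m.M j)ᵀ = m.M j) :
    m.EnergyPreserving := by
  intro d S H hP h y₀ y₁ Y Z hs
  obtain ⟨v, hY, hZ, rfl, hv⟩ := (m.isStep_iff hP).1 hs
  have hc := hs.continuous
  have hn : Continuous fun τ => ∇ H (Y τ) := hP.contDiff_gradient.continuous.comp hc
  have hder : ∀ τ, HasDerivAt (fun τ => H (Y τ))
      (inner ℝ (∇ H (Y τ)) (h • ∑ k : Fin s, τ ^ (k : ℕ) • v k)) τ := by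
    intro τ
    have h1 : HasFDerivAt H (InnerProductSpace.toDual ℝ _ (∇ H (Y τ))) (Y τ) :=
      hP.hasGradientAt (Y τ)
    have h2 : HasDerivAt Y (h • ∑ k : Fin s, τ ^ (k : ℕ) • v k) τ :=
      hY ▸ hasDerivAt_stagePoly y₀ h v τ
    exact h1.comp_hasDerivAt τ h2
  have hftc := intervalIntegral.integral_eq_sub_of_hasDerivAt (a := 0) (b := 1)
    (fun τ _ => hder τ) (Continuous.intervalIntegrable (by fun_prop) _ _)
  have hY0 : Y 0 = y₀ := by rw [hY, stagePoly_zero]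
  set N : Fin s → EuclideanSpace ℝ (Fin d) :=
    fun l => ∫ τ in (0 : ℝ)..1, τ ^ (l : ℕ) • ∇ H (Y τ) with hN
  -- The matrix `S (Y (m.c j))` does not depend on the integration variable, so it leaves the
  -- integral. This is what the partitioning into `Y` and `Z` achieves.
  have hvN : ∀ k, v k = ∑ j, ∑ l, m.M j k l • Matrix.toEuclideanLin (S (Y (m.c j))) (N l) := by
    intro k
    rw [hv k, stageCoeff]
    refine Finset.sum_congr rfl fun j _ => Finset.sum_congr rfl fun l _ => ?_
    congr 1
    have := (Matrix.toEuclideanCLM (𝕜 := ℝ) (S (Y (m.c j)))).intervalIntegral_comp_comm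
      (μ := MeasureTheory.volume) (a := 0) (b := 1) (f := fun τ => τ ^ (l : ℕ) • ∇ H (Y τ))
      (Continuous.intervalIntegrable (by fun_prop) _ _)
    refine Eq.trans ?_ this
    refine intervalIntegral.integral_congr fun τ _ => ?_
    change τ ^ (l : ℕ) • Matrix.toEuclideanLin (S (Y (m.c j))) (∇ H (Y τ)) =
      Matrix.toEuclideanLin (S (Y (m.c j))) (τ ^ (l : ℕ) • ∇ H (Y τ))
    rw [map_smul]
  have hintegral : ∫ τ in (0 : ℝ)..1, inner ℝ (∇ H (Y τ)) (h • ∑ k : Fin s, τ ^ (k : ℕ) • v k) =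
      h * ∑ k, inner ℝ (N k) (v k) := by
    simp_rw [inner_smul_right, inner_sum, inner_smul_right]
    rw [intervalIntegral.integral_const_mul, intervalIntegral.integral_finsetSum]
    · congr 1
      refine Finset.sum_congr rfl fun k _ => ?_
      rw [real_inner_comm]
      have := (innerSL ℝ (v k)).intervalIntegral_comp_comm
        (μ := MeasureTheory.volume) (a := 0) (b := 1) (f := fun τ => τ ^ (k : ℕ) • ∇ H (Y τ))
        (Continuous.intervalIntegrable (by fun_prop) _ _)
      simp only [innerSL_apply_apply, inner_smul_right] at this
      rw [hN, ← this]
      simp_rw [real_inner_comm]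
    · intro k _
      exact Continuous.intervalIntegrable (by fun_prop) _ _
  have hzero : ∑ k, inner ℝ (N k) (v k) = 0 := by
    have hexp : ∑ k, inner ℝ (N k) (v k) = ∑ j, ∑ k, ∑ l, m.M j k l *
        inner ℝ (N k) (Matrix.toEuclideanLin (S (Y (m.c j))) (N l)) := by
      simp_rw [hvN, inner_sum, inner_smul_right]
      rw [Finset.sum_comm]
    rw [hexp]
    refine Finset.sum_eq_zero fun j _ => ?_
    -- Exchanging `k` and `l` fixes the symmetric weight and changes the sign of the skew form.
    have hneg : ∑ k, ∑ l, m.M j k l *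
        inner ℝ (N k) (Matrix.toEuclideanLin (S (Y (m.c j))) (N l)) =
        - ∑ k, ∑ l, m.M j k l *
        inner ℝ (N k) (Matrix.toEuclideanLin (S (Y (m.c j))) (N l)) := by
      conv_lhs => rw [Finset.sum_comm]
      simp_rw [← Finset.sum_neg_distrib]
      refine Finset.sum_congr rfl fun k _ => Finset.sum_congr rfl fun l _ => ?_
      rw [hP.inner_skew, ← hM j, Matrix.transpose_apply]
      rw [hM j]
      ring
    linarith
  rw [hintegral, hzero, mul_zero, hY0] at hftc
  linarith

/-- Subtracting the stage equation at `1 - τ` from the one at `1` leaves the kernel `A_1 - A_{1-τ}`;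
by `hA` and the substitution `ζ ↦ 1 - ζ` this is the kernel of the method itself with the stages in
reverse order, and `hc` says that the nodes reverse accordingly. -/
theorem isStep_reverse (m : PCSRK s)
    (hA : ∀ τ j ζ, m.A 1 j ζ - m.A (1 - τ) j ζ = m.A τ j.rev (1 - ζ))
    (hc : ∀ j : Fin s, m.c j.rev = 1 - m.c j) {k : ℕ} (hP : IsPoissonSystem k S H) {h : ℝ}
    {y₀ y₁ : EuclideanSpace ℝ (Fin d)}
    {Y : ℝ → EuclideanSpace ℝ (Fin d)} {Z : Fin s → EuclideanSpace ℝ (Fin d)}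
    (hs : m.IsStep S H h y₀ Y Z y₁) :
    m.IsStep S H (-h) y₁ (fun τ => Y (1 - τ)) (fun i => Z i.rev) y₀ := by
  have hY := hs.continuous
  have hg := fun j => hP.continuous_poissonField (Z j) hY
  have hAc : ∀ τ j, Continuous fun ζ => m.A τ j ζ := by
    intro τ j
    simp_rw [A_eq_sum]
    fun_prop
  have hAg : ∀ τ j, Continuous fun ζ => m.A τ j ζ • poissonField S H (Z j) (Y ζ) :=
    fun τ j => (hAc τ j).smul (hg j)
  have hY0 : Y 0 = y₀ := by
    have := hs.stage_Y 0 (by simp)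
    simpa [A_eq_sum] using this
  have hY1 : Y 1 = y₁ := by
    rw [hs.output, hs.stage_Y 1 (by simp)]
    rfl
  have key : ∀ τ ∈ Set.Icc (0 : ℝ) 1, Y (1 - τ) = y₁ + (-h) • ∑ j : Fin s,
      ∫ ζ in (0 : ℝ)..1, m.A τ j ζ • poissonField S H (Z j.rev) (Y (1 - ζ)) := by
    intro τ hτ
    have e1 : ∑ j : Fin s,
        ∫ ζ in (0 : ℝ)..1, m.A τ j ζ • poissonField S H (Z j.rev) (Y (1 - ζ)) =
        ∑ j : Fin s, ((∫ ζ in (0 : ℝ)..1, m.A 1 j ζ • poissonField S H (Z j) (Y ζ)) -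
          ∫ ζ in (0 : ℝ)..1, m.A (1 - τ) j ζ • poissonField S H (Z j) (Y ζ)) := by
      rw [← Equiv.sum_comp Fin.revPerm]
      refine Finset.sum_congr rfl fun j _ => ?_
      rw [← intervalIntegral.integral_sub
        (hAg 1 j |>.intervalIntegrable _ _) (hAg (1 - τ) j |>.intervalIntegrable _ _)]
      have := intervalIntegral.integral_comp_sub_left (a := 0) (b := 1)
        (fun ζ => m.A τ j.rev (1 - ζ) • poissonField S H (Z j) (Y ζ)) 1
      simp only [sub_self, sub_zero, sub_sub_cancel] at this
      simp only [Fin.revPerm_apply, Fin.rev_rev, this]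
      refine intervalIntegral.integral_congr fun ζ _ => ?_
      simp only [← hA, sub_smul]
    rw [e1, Finset.sum_sub_distrib, ← hY1, hs.stage_Y 1 (by simp),
      hs.stage_Y (1 - τ) ⟨by linarith [hτ.2], by linarith [hτ.1]⟩]
    module
  refine ⟨?_, key, fun i => ?_, ?_⟩
  · obtain ⟨a, ha⟩ := hs.isPolynomial
    -- Binomial expansion of `(1 - τ)^k`; since `Nat.choose k i = 0` for `i > k`, all powers can be
    -- expanded over the same index range.
    refine ⟨fun i => ∑ k : Fin (s + 1), ((Nat.choose k i : ℝ) * (-1) ^ (i : ℕ)) • a k, fun τ => ?_⟩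
    have hbin : ∀ k : Fin (s + 1), (1 - τ) ^ (k : ℕ) =
        ∑ i : Fin (s + 1), τ ^ (i : ℕ) * ((Nat.choose k i : ℝ) * (-1) ^ (i : ℕ)) := by
      intro k
      rw [Fin.sum_univ_eq_sum_range
        (fun i => τ ^ i * ((Nat.choose k i : ℝ) * (-1) ^ i)) (s + 1)]
      rw [← Finset.sum_subset (Finset.range_subset_range.2 (Nat.succ_le_of_lt k.2))]
      · rw [sub_eq_neg_add, add_pow]
        refine Finset.sum_congr rfl fun i _ => ?_
        rw [neg_pow]
        ring
      · intro i _ hi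
        rw [Nat.choose_eq_zero_of_lt (by simpa using hi)]
        simp
    simp only [ha, hbin, Finset.sum_smul, Finset.smul_sum, smul_smul]
    rw [Finset.sum_comm]
  · have hci := m.c_mem i
    have h2 := key (m.c i) hci
    rw [← h2, ← hc, hs.stage_Z, hs.stage_Y _ (m.c_mem i.rev)]
  · have := key 1 (by simp)
    simpa [hY0, B] using this

theorem symmetric_of_A_reverse (m : PCSRK s)
    (hA : ∀ τ j ζ, m.A 1 j ζ - m.A (1 - τ) j ζ = m.A τ j.rev (1 - ζ))
    (hc : ∀ j : Fin s, m.c j.rev = 1 - m.c j) : m.Symmetric := by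
  intro d S H hP h y₀ y₁
  constructor
  · rintro ⟨Y, Z, hs⟩
    exact ⟨_, _, m.isStep_reverse hA hc hP hs⟩
  · rintro ⟨Y, Z, hs⟩
    exact ⟨_, _, neg_neg h ▸ m.isStep_reverse hA hc hP hs⟩

end PCSRK

/-! ### Reflection of the kernels and the moment conditions for order four. -/

namespace PCSRK

/-- Reflection `τ ↦ 1 - τ`, `ζ ↦ 1 - ζ` of a kernel in terms of its coefficient matrix. -/
theorem coeffMatrix_reverse {m : PCSRK 3} {α : ℝ}
    (h_sum : !![1, 1/2, 1/3; 1/2, 1/3, 1/4; 1/3, 1/4, α] * (m.M 0 + m.M 1 + m.M 2) = 1)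
    (h_transf : !![1, 1, 1; 0, -1, -2; 0, 0, 1] * m.M 2 * !![1, 0, 0; 1, -1, 0; 1, -2, 1]
      = m.M 0) (j : Fin 3) :
    !![1, 1, 1; 0, -1, -2; 0, 0, 1] * m.M j * !![1, 0, 0; 1, -1, 0; 1, -2, 1] = m.M j.rev := by
  set R : Matrix (Fin 3) (Fin 3) ℝ := !![1, 1, 1; 0, -1, -2; 0, 0, 1] with hR
  set L : Matrix (Fin 3) (Fin 3) ℝ := !![1, 0, 0; 1, -1, 0; 1, -2, 1] with hL
  set K : Matrix (Fin 3) (Fin 3) ℝ := !![1, 1/2, 1/3; 1/2, 1/3, 1/4; 1/3, 1/4, α] with hK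
  have hRR : R * R = 1 := by
    ext i k; fin_cases i <;> fin_cases k <;> simp [hR, Matrix.mul_apply, Fin.sum_univ_three]
      <;> norm_num
  have hLL : L * L = 1 := by
    ext i k; fin_cases i <;> fin_cases k <;> simp [hL, Matrix.mul_apply, Fin.sum_univ_three]
      <;> norm_num
  -- For `α = 1/5`, `K` is the Gram matrix of `1, ζ, ζ²` on `[0, 1]`, which is invariant under `ζ ↦
  -- 1 - ζ`. The entry `α` enters both sides only in the last diagonal position, and equally, so its
  -- value does not matter.
  have hKR : K * R = L * K := by
    ext i k; fin_cases i <;> fin_cases k <;>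
      simp [hK, hR, hL, Matrix.mul_apply, Fin.sum_univ_three] <;> ring
  have h0 : R * m.M 0 * L = m.M 2 := by
    calc R * m.M 0 * L = (R * R) * m.M 2 * (L * L) := by rw [← h_transf]; simp only [mul_assoc]
      _ = m.M 2 := by rw [hRR, hLL, one_mul, mul_one]
  -- Both sides are inverse to `K`.
  have hsum : R * (m.M 0 + m.M 1 + m.M 2) * L = m.M 0 + m.M 1 + m.M 2 := by
    have h1 : K * (R * (m.M 0 + m.M 1 + m.M 2) * L) = 1 := by
      rw [← mul_assoc, ← mul_assoc, hKR, mul_assoc L, h_sum, mul_one, hLL]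
    exact (left_inv_eq_right_inv (mul_eq_one_comm.1 h_sum) h1).symm
  fin_cases j
  · exact h0
  -- Reflection swaps the outer matrices and preserves the total, so it fixes the middle one.
  · have : R * m.M 1 * L = m.M 1 := by
      rw [mul_add, mul_add, add_mul, add_mul, h0, h_transf] at hsum
      have h3 : m.M 2 + R * m.M 1 * L + m.M 0 = m.M 2 + m.M 1 + m.M 0 := by rw [hsum]; abel
      exact add_left_cancel (add_right_cancel h3)
    exact this
  · exact h_transf

/-- The left side is the integral of the kernel over `[1 - τ, 1]`; reflecting the variable moves it
to `[0, τ]`. -/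
theorem A_reverse {m : PCSRK 3}
    (hM : ∀ j : Fin 3, !![1, 1, 1; 0, -1, -2; 0, 0, 1] * m.M j * !![1, 0, 0; 1, -1, 0; 1, -2, 1]
      = m.M j.rev) (τ : ℝ) (j : Fin 3) (ζ : ℝ) :
    m.A 1 j ζ - m.A (1 - τ) j ζ = m.A τ j.rev (1 - ζ) := by
  simp only [A, ← hM, Matrix.mul_apply, dotProduct, Matrix.mulVec, Fin.sum_univ_three]
  simp
  ring

/-- The moment `∫∫ τ^a ζ^c K_j(τ, ζ) dτ dζ` of the kernel `K_j` with coefficient matrix `M_j`. -/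
noncomputable def doubleMoment (m : PCSRK 3) (j : Fin 3) (a c : ℕ) : ℝ :=
  ∑ k : Fin 3, ∑ l : Fin 3, m.M j k l / (((k : ℕ) + a + 1) * ((l : ℕ) + c + 1))

/-- The coefficient of `τ^k` in `∑ j, ∫ c_j^b ζ^c K_j(τ, ζ) dζ`. -/
noncomputable def nodeMoment {s : ℕ} (m : PCSRK s) (k : Fin s) (b c : ℕ) : ℝ :=
  ∑ j, m.c j ^ b * ∑ l : Fin s, m.M j k l / ((l : ℕ) + c + 1)

theorem sum_nodeMoment_div (m : PCSRK 3) (a b c : ℕ) :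
    ∑ k : Fin 3, m.nodeMoment k b c / ((k : ℕ) + a + 1) = ∑ j, m.c j ^ b * m.doubleMoment j a c := by
  simp only [nodeMoment, doubleMoment, Finset.sum_div, Finset.mul_sum]
  rw [Finset.sum_comm]
  refine Finset.sum_congr rfl fun j _ => Finset.sum_congr rfl fun k _ =>
    Finset.sum_congr rfl fun l _ => ?_
  field_simp

end PCSRK

/-- The conditions on the coefficients that give order four, in terms of moments. -/
structure PCSRK.OrderFourConditions (m : PCSRK 3) : Prop where
  moment_zero_zero : ∀ k, m.nodeMoment k 0 0 = if k = 0 then 1 else 0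
  moment_zero_one : ∀ k, m.nodeMoment k 0 1 = if k = 1 then 1 else 0
  moment_one_zero : ∀ k, m.nodeMoment k 1 0 = if k = 1 then 1 else 0
  integral_eq : ∀ b c, b + c ≤ 3 →
    ∑ k : Fin 3, m.nodeMoment k b c / ((k : ℕ) + 1) = 1 / ((b + c : ℕ) + 1)
  integral_mul_eq : ∀ b c, b + c ≤ 2 →
    ∑ k : Fin 3, m.nodeMoment k b c / ((k : ℕ) + 2) = 1 / ((b + c : ℕ) + 2)

namespace PCSRK

theorem orderFourConditions {m : PCSRK 3} {α : ℝ}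
    (h_symm : ∀ i, (m.M i)ᵀ = m.M i)
    (h_sum : !![1, 1/2, 1/3; 1/2, 1/3, 1/4; 1/3, 1/4, α] * (m.M 0 + m.M 1 + m.M 2) = 1)
    (hM : ∀ j : Fin 3, !![1, 1, 1; 0, -1, -2; 0, 0, 1] * m.M j * !![1, 0, 0; 1, -1, 0; 1, -2, 1]
      = m.M j.rev)
    (h_nodes : m.c 0 + m.c 2 = 1 ∧ m.c 1 = 1/2)
    (h_lin : (m.c 0 • m.M 0 + m.c 1 • m.M 1 + m.c 2 • m.M 2) *ᵥ ![1, 1/2, 1/3] = ![0, 1, 0])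
    (h_quad : ![1, 1/2, 1/3] ⬝ᵥ
      ((m.c 0 ^ 2 • m.M 0 + m.c 1 ^ 2 • m.M 1 + m.c 2 ^ 2 • m.M 2) *ᵥ ![1, 1/2, 1/3]) = 1/3) :
    m.OrderFourConditions := by
  have hsym : ∀ j k l, m.M j k l = m.M j l k := fun j k l => by
    conv_lhs => rw [← h_symm j, Matrix.transpose_apply]
  -- Only the first two columns of this product are used below; the unknown `α` sits in the third.
  have h_sum' := mul_eq_one_comm.1 h_sum
  have m00 : ∀ k, m.nodeMoment k 0 0 = if k = 0 then 1 else 0 := by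
    intro k
    have h1 := congrFun (congrFun h_sum' k) 0
    simp [Matrix.mul_apply, Fin.sum_univ_three, Matrix.one_apply] at h1
    rw [← h1]
    simp [nodeMoment, Fin.sum_univ_three]
    ring
  have m01 : ∀ k, m.nodeMoment k 0 1 = if k = 1 then 1 else 0 := by
    intro k
    have h1 := congrFun (congrFun h_sum' k) 1
    simp [Matrix.mul_apply, Fin.sum_univ_three, Matrix.one_apply] at h1
    rw [← h1]
    simp [nodeMoment, Fin.sum_univ_three]
    ring
  have m10 : ∀ k, m.nodeMoment k 1 0 = if k = 1 then 1 else 0 := by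
    intro k
    have h1 := congrFun h_lin k
    have h2 : (![0, 1, 0] : Fin 3 → ℝ) k = if k = 1 then 1 else 0 := by
      fin_cases k <;> simp
    rw [h2] at h1
    rw [← h1]
    simp [nodeMoment, Fin.sum_univ_three, Matrix.mulVec, dotProduct]
    ring
  have xsym : ∀ j a c, m.doubleMoment j a c = m.doubleMoment j c a := by
    intro j a c
    simp only [doubleMoment]
    rw [Finset.sum_comm]
    refine Finset.sum_congr rfl fun k _ => Finset.sum_congr rfl fun l _ => ?_
    rw [hsym j l k, mul_comm]
  have s0 : ∀ a, ∑ j, m.doubleMoment j a 0 = 1 / (a + 1) := by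
    intro a
    have := m.sum_nodeMoment_div a 0 0
    simp [m00, Fin.sum_univ_three] at this ⊢
    linarith
  have s1 : ∀ a, ∑ j, m.doubleMoment j a 1 = 1 / (a + 2) := by
    intro a
    have := m.sum_nodeMoment_div a 0 1
    simp [m01, Fin.sum_univ_three] at this ⊢
    rw [← this, inv_inj]
    ring
  have l0 : ∀ a, ∑ j, m.c j * m.doubleMoment j a 0 = 1 / (a + 2) := by
    intro a
    have := m.sum_nodeMoment_div a 1 0
    simp [m10, Fin.sum_univ_three] at this ⊢
    rw [← this, inv_inj]
    ring
  have q0 : ∑ j, m.c j ^ 2 * m.doubleMoment j 0 0 = 1 / 3 := by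
    rw [← h_quad]
    simp [doubleMoment, Fin.sum_univ_three, Matrix.mulVec, dotProduct]
    ring
  -- Moments taken about the centre `1/2` have a parity under `j ↦ j.rev`: those of degree zero
  -- (`rx`) and bidegree `(1, 1)` (`rq`) are even, those of degree one (`rp`) are odd.
  have rx : m.doubleMoment 0 0 0 = m.doubleMoment 2 0 0 := by
    simp only [doubleMoment]
    rw [show m.M 0 = _ from (hM 2).symm]
    simp only [Fin.sum_univ_three, Matrix.mul_apply]
    simp
    ring
  have rp : ∀ j : Fin 3, m.doubleMoment j.rev 0 1 - m.doubleMoment j.rev 0 0 / 2 =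
      -(m.doubleMoment j 0 1 - m.doubleMoment j 0 0 / 2) := by
    intro j
    simp only [doubleMoment, ← hM j, Fin.sum_univ_three, Matrix.mul_apply]
    simp
    ring
  have rp0 : m.doubleMoment 0 0 1 - m.doubleMoment 0 0 0 / 2 =
      -(m.doubleMoment 2 0 1 - m.doubleMoment 2 0 0 / 2) := rp 2
  have rp1 : m.doubleMoment 1 0 1 - m.doubleMoment 1 0 0 / 2 =
      -(m.doubleMoment 1 0 1 - m.doubleMoment 1 0 0 / 2) := rp 1
  have rq : m.doubleMoment 0 1 1 - m.doubleMoment 0 0 1 / 2 - m.doubleMoment 0 1 0 / 2 +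
      m.doubleMoment 0 0 0 / 4 = m.doubleMoment 2 1 1 - m.doubleMoment 2 0 1 / 2 -
      m.doubleMoment 2 1 0 / 2 + m.doubleMoment 2 0 0 / 4 := by
    simp only [doubleMoment]
    rw [show m.M 0 = _ from (hM 2).symm]
    simp only [Fin.sum_univ_three, Matrix.mul_apply]
    simp
    ring
  have t0 : ∀ c, ∑ j, m.doubleMoment j 0 c = 1 / (c + 1) := fun c => by
    simp_rw [xsym _ 0 c]; exact s0 c
  have t1 : ∀ c, ∑ j, m.doubleMoment j 1 c = 1 / (c + 2) := fun c => by
    simp_rw [xsym _ 1 c]; exact s1 c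
  have k0 : ∀ c, ∑ j, m.c j * m.doubleMoment j 0 c = 1 / (c + 2) := fun c => by
    simp_rw [xsym _ 0 c]; exact l0 c
  have hc0 : m.c 0 = 1 - m.c 2 := by linarith [h_nodes.1]
  have hc1 : m.c 1 = 1 / 2 := h_nodes.2
  have hx10 := fun j => xsym j 1 0
  -- The centred moments `p_j` are odd and `c_0 + c_2 = 1`, so `∑ c_j² p_j = (c_2² - c_0²) p_2 =
  -- (c_2 - c_0) p_2 = ∑ c_j p_j`, which is known.
  have p2 : ∑ j, m.c j ^ 2 * m.doubleMoment j 0 1 = 1 / 4 := by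
    have e1 := k0 1
    have e2 := k0 0
    simp only [Fin.sum_univ_three, hc0, hc1, Nat.cast_one, Nat.cast_zero] at e1 e2 q0 ⊢
    have hX : m.doubleMoment 1 0 1 = m.doubleMoment 1 0 0 / 2 := by linarith
    have hY : m.doubleMoment 0 0 1 = m.doubleMoment 0 0 0 / 2 -
      (m.doubleMoment 2 0 1 - m.doubleMoment 2 0 0 / 2) := by linarith
    rw [hX, hY] at e1 ⊢
    linear_combination e1 + q0 / 2 - e2 / 2
  -- `∑ (c_j - 1/2)³ x_j = 0`, an odd weight against the even zeroth moments `x_j`; expanding the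
  -- cube reduces to lower powers of `c_j`.
  have x3 : ∑ j, m.c j ^ 3 * m.doubleMoment j 0 0 = 1 / 4 := by
    have e2 := k0 0
    have e3 := s0 0
    simp only [Fin.sum_univ_three, hc0, hc1, Nat.cast_zero, rx] at e2 e3 q0 ⊢
    linear_combination 3 / 2 * q0 - 3 / 4 * e2 + e3 / 8
  -- Again odd against even: `c_j - 1/2` is summed against the centred `(1, 1)` moments of `rq`.
  have y1 : ∑ j, m.c j * m.doubleMoment j 1 1 = 1 / 4 := by
    have e1 := k0 1
    have e2 := k0 0
    have e3 := s1 1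
    have e4 := s1 0
    have e5 := s0 0
    simp only [Fin.sum_univ_three, hc0, hc1, Nat.cast_one, Nat.cast_zero, hx10] at e1 e2 e3 e4 e5 rq ⊢
    have hX : m.doubleMoment 0 1 1 = m.doubleMoment 2 1 1 - m.doubleMoment 2 0 1 +
      m.doubleMoment 2 0 0 / 4 + m.doubleMoment 0 0 1 - m.doubleMoment 0 0 0 / 4 := by linarith
    rw [hX] at e3 ⊢
    linear_combination e1 - e2 / 4 + e3 / 2 - e4 / 2 + e5 / 8
  refine ⟨m00, m01, m10, fun b c hbc => ?_, fun b c hbc => ?_⟩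
  · have h := m.sum_nodeMoment_div 0 b c
    simp only [Nat.cast_zero, add_zero] at h
    rw [h]
    rcases b with _ | _ | _ | _ | b
    · simpa using t0 c
    · rw [zero_add]
      simp only [pow_one]
      rw [k0]
      push_cast
      ring
    · rcases c with _ | _ | c
      · rw [q0]; norm_num
      · rw [p2]; norm_num
      · omega
    · obtain rfl : c = 0 := by omega
      rw [x3]; norm_num
    · omega
  · have h := m.sum_nodeMoment_div 1 b c
    have h' : ∀ k : Fin 3, (((k : ℕ) : ℝ) + (1 : ℕ) + 1) = (k : ℕ) + 2 := fun k => by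
      push_cast; ring
    simp only [h'] at h
    rw [h]
    rcases b with _ | _ | _ | b
    · simpa using t1 c
    · rcases c with _ | _ | c
      · have := l0 1
        simp only [zero_add, pow_one, Nat.cast_one] at this ⊢
        rw [this]
        norm_num
      · rw [zero_add]
        simp only [pow_one]
        rw [y1]; norm_num
      · omega
    · obtain rfl : c = 0 := by omega
      simp_rw [zero_add, xsym _ 1 0]
      rw [p2]; norm_num
    · omega

end PCSRK

universe u

/-! ### Calculus of expansions in `τ` with coefficients of size `h^k`. -/

section Jets

variable {ι : Type*} {h : ι → ℝ} {p q : ℕ}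
  {E G : Type*} [NormedAddCommGroup E] [NormedAddCommGroup G]

/-- A family of functions on `[0, 1]` is uniformly `O(h^p)`. -/
def UnifBigO (h : ι → ℝ) (p : ℕ) (R : ι → ℝ → G) : Prop :=
  ∃ C : ℝ, ∀ i, ∀ τ ∈ Set.Icc (0 : ℝ) 1, ‖R i τ‖ ≤ C * |h i| ^ p

namespace UnifBigO

variable {R R' : ι → ℝ → G}

theorem exists_nonneg (hR : UnifBigO h p R) :
    ∃ C : ℝ, 0 ≤ C ∧ ∀ i, ∀ τ ∈ Set.Icc (0 : ℝ) 1, ‖R i τ‖ ≤ C * |h i| ^ p := by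
  obtain ⟨C, hC⟩ := hR
  refine ⟨|C|, abs_nonneg C, fun i τ hτ => (hC i τ hτ).trans ?_⟩
  gcongr
  exact le_abs_self C

theorem congr (hR : UnifBigO h p R) (he : ∀ i, ∀ τ ∈ Set.Icc (0 : ℝ) 1, R' i τ = R i τ) :
    UnifBigO h p R' := by
  obtain ⟨C, hC⟩ := hR
  exact ⟨C, fun i τ hτ => he i τ hτ ▸ hC i τ hτ⟩

theorem of_norm_le {G' : Type*} [NormedAddCommGroup G'] {R' : ι → ℝ → G'} (hR : UnifBigO h p R)
    (K : ℝ) (he : ∀ i, ∀ τ ∈ Set.Icc (0 : ℝ) 1, ‖R' i τ‖ ≤ K * ‖R i τ‖) :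
    UnifBigO h p R' := by
  obtain ⟨C, hC0, hC⟩ := hR.exists_nonneg
  refine ⟨|K| * C, fun i τ hτ => (he i τ hτ).trans ?_⟩
  rw [mul_assoc]
  exact mul_le_mul (le_abs_self K) (hC i τ hτ) (norm_nonneg _) (abs_nonneg _)

theorem zero : UnifBigO h p (fun _ _ => (0 : G)) :=
  ⟨0, fun i τ _ => by simp⟩

theorem add (hR : UnifBigO h p R) (hR' : UnifBigO h p R') :
    UnifBigO h p (fun i τ => R i τ + R' i τ) := by
  obtain ⟨C, hC⟩ := hR
  obtain ⟨C', hC'⟩ := hR'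
  refine ⟨C + C', fun i τ hτ => (norm_add_le _ _).trans ?_⟩
  rw [add_mul]
  exact add_le_add (hC i τ hτ) (hC' i τ hτ)

theorem neg (hR : UnifBigO h p R) : UnifBigO h p (fun i τ => -R i τ) := by
  obtain ⟨C, hC⟩ := hR
  exact ⟨C, fun i τ hτ => by rw [norm_neg]; exact hC i τ hτ⟩

theorem sub (hR : UnifBigO h p R) (hR' : UnifBigO h p R') :
    UnifBigO h p (fun i τ => R i τ - R' i τ) :=
  (hR.add hR'.neg).congr fun _ _ _ => sub_eq_add_neg _ _

theorem sum {κ : Type*} (T : Finset κ) {R : κ → ι → ℝ → G}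
    (hR : ∀ t ∈ T, UnifBigO h p (R t)) : UnifBigO h p (fun i τ => ∑ t ∈ T, R t i τ) := by
  classical
  induction T using Finset.induction_on with
  | empty => exact zero.congr fun i τ _ => by simp
  | insert t T ht ih =>
    refine ((hR t (by simp)).add (ih fun t' ht' => hR t' (by simp [ht']))).congr fun i τ _ => ?_
    rw [Finset.sum_insert ht]

theorem mono (hh : ∀ i, |h i| ≤ 1) (hR : UnifBigO h p R) (hqp : q ≤ p) : UnifBigO h q R := by
  obtain ⟨C, hC0, hC⟩ := hR.exists_nonneg
  refine ⟨C, fun i τ hτ => (hC i τ hτ).trans ?_⟩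
  exact mul_le_mul_of_nonneg_left (pow_le_pow_of_le_one (abs_nonneg _) (hh i) hqp) hC0

theorem of_bound (C : ℝ) (hC : ∀ i, ∀ τ ∈ Set.Icc (0 : ℝ) 1, ‖R i τ‖ ≤ C) : UnifBigO h 0 R :=
  ⟨C, fun i τ hτ => by simpa using hC i τ hτ⟩

theorem exists_bound (hR : UnifBigO h 0 R) :
    ∃ C, ∀ i, ∀ τ ∈ Set.Icc (0 : ℝ) 1, ‖R i τ‖ ≤ C := by
  obtain ⟨C, hC⟩ := hR
  exact ⟨C, fun i τ hτ => by simpa using hC i τ hτ⟩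

theorem const (x : G) : UnifBigO h 0 (fun _ _ => x) := of_bound ‖x‖ fun _ _ _ => le_rfl

theorem pow (k : ℕ) : UnifBigO h 0 (fun _ τ => τ ^ k) :=
  of_bound 1 fun _ τ hτ => by
    rw [norm_pow, Real.norm_eq_abs, abs_of_nonneg hτ.1]
    exact pow_le_one₀ hτ.1 hτ.2

theorem step : UnifBigO h 1 (fun i _ => h i) := ⟨1, fun i _ _ => by simp⟩

theorem comp (hR : UnifBigO h q R) {θ : ℝ → ℝ}
    (hθ : Set.MapsTo θ (Set.Icc (0 : ℝ) 1) (Set.Icc (0 : ℝ) 1)) :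
    UnifBigO h q (fun i τ => R i (θ τ)) := by
  obtain ⟨C, hC⟩ := hR
  exact ⟨C, fun i τ hτ => hC i _ (hθ hτ)⟩

theorem evalAt (hR : UnifBigO h q R) {t : ℝ} (ht : t ∈ Set.Icc (0 : ℝ) 1) :
    UnifBigO h q (fun i _ => R i t) :=
  hR.comp fun _ _ => ht

variable [NormedSpace ℝ E] [NormedSpace ℝ G]

theorem clm_apply {A : ι → ℝ → E →L[ℝ] G} {x : ι → ℝ → E} (hA : UnifBigO h p A)
    (hx : UnifBigO h q x) : UnifBigO h (p + q) (fun i τ => A i τ (x i τ)) := by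
  obtain ⟨C, hC0, hC⟩ := hA.exists_nonneg
  obtain ⟨C', hC'⟩ := hx
  refine ⟨C * C', fun i τ hτ => ((A i τ).le_opNorm _).trans ?_⟩
  refine (mul_le_mul (hC i τ hτ) (hC' i τ hτ) (norm_nonneg _) (by positivity)).trans_eq ?_
  rw [pow_add]
  ring

theorem smul {φ : ι → ℝ → ℝ} (hφ : UnifBigO h p φ) (hR : UnifBigO h q R) :
    UnifBigO h (p + q) (fun i τ => φ i τ • R i τ) := by
  obtain ⟨C, hC0, hC⟩ := hφ.exists_nonneg
  obtain ⟨C', hC'⟩ := hR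
  refine ⟨C * C', fun i τ hτ => (norm_smul_le _ _).trans ?_⟩
  refine (mul_le_mul (hC i τ hτ) (hC' i τ hτ) (norm_nonneg _) (by positivity)).trans_eq ?_
  rw [pow_add]
  ring

theorem bdd_smul {φ : ι → ℝ → ℝ} (hφ : UnifBigO h 0 φ) (hR : UnifBigO h q R) :
    UnifBigO h q (fun i τ => φ i τ • R i τ) := by
  simpa using hφ.smul hR

theorem pow_smul (k : ℕ) (hR : UnifBigO h q R) : UnifBigO h q (fun i τ => τ ^ k • R i τ) :=
  (pow k).bdd_smul hR

theorem const_smul (x : ℝ) (hR : UnifBigO h q R) : UnifBigO h q (fun i τ => x • R i τ) :=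
  (const x).bdd_smul hR

theorem step_smul (hR : UnifBigO h q R) : UnifBigO h (q + 1) (fun i τ => h i • R i τ) := by
  rw [add_comm]
  exact step.smul hR

theorem integral (hR : UnifBigO h q R) : UnifBigO h q (fun i τ => ∫ s in (0 : ℝ)..τ, R i s) := by
  obtain ⟨C, hC0, hC⟩ := hR.exists_nonneg
  refine ⟨C, fun i τ hτ => ?_⟩
  have h1 : ‖∫ s in (0 : ℝ)..τ, R i s‖ ≤ C * |h i| ^ q * |τ - 0| := by
    refine intervalIntegral.norm_integral_le_of_norm_le_const fun s hs => hC i s ?_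
    rw [Set.uIoc_of_le hτ.1] at hs
    exact ⟨hs.1.le, hs.2.trans hτ.2⟩
  refine h1.trans (mul_le_of_le_one_right (by positivity) ?_)
  rw [sub_zero, abs_of_nonneg hτ.1]
  exact hτ.2

end UnifBigO

variable [NormedSpace ℝ E] [NormedSpace ℝ G]

/-- Expansion of a family of functions on `[0, 1]` in powers of `τ`, the coefficient of `τ^k`
being `O(h^k)`, up to `O(h^p)`. -/
structure IsJet (h : ι → ℝ) (p : ℕ) (f : ι → ℝ → G) (c : ι → ℕ → G) : Prop where
  coeff : ∀ k < p, UnifBigO h k (fun i _ => c i k)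
  remainder : UnifBigO h p (fun i τ => f i τ - ∑ k ∈ Finset.range p, τ ^ k • c i k)

/-- Existence of an expansion in the sense of `IsJet`. -/
def HasJet (h : ι → ℝ) (p : ℕ) (f : ι → ℝ → G) : Prop := ∃ c, IsJet h p f c

namespace HasJet

variable {f g : ι → ℝ → G}

theorem congr (hf : HasJet h p f) (he : ∀ i, ∀ τ ∈ Set.Icc (0 : ℝ) 1, g i τ = f i τ) :
    HasJet h p g := by
  obtain ⟨c, hc⟩ := hf
  exact ⟨c, hc.coeff, hc.remainder.congr fun i τ hτ => by rw [he i τ hτ]⟩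

theorem add (hf : HasJet h p f) (hg : HasJet h p g) :
    HasJet h p (fun i τ => f i τ + g i τ) := by
  obtain ⟨c, hc⟩ := hf
  obtain ⟨c', hc'⟩ := hg
  refine ⟨fun i k => c i k + c' i k, fun k hk => (hc.coeff k hk).add (hc'.coeff k hk),
    (hc.remainder.add hc'.remainder).congr fun i τ _ => ?_⟩
  simp only [smul_add, Finset.sum_add_distrib]
  abel

theorem of_unifBigO (hf : UnifBigO h p f) : HasJet h p f :=
  ⟨fun _ _ => 0, fun _ _ => UnifBigO.zero, hf.congr fun i τ _ => by simp⟩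

theorem sum {κ : Type*} (T : Finset κ) {f : κ → ι → ℝ → G}
    (hf : ∀ t ∈ T, HasJet h p (f t)) : HasJet h p (fun i τ => ∑ t ∈ T, f t i τ) := by
  classical
  induction T using Finset.induction_on with
  | empty => exact (of_unifBigO UnifBigO.zero).congr fun i τ _ => by simp
  | insert t T ht ih =>
    refine ((hf t (by simp)).add (ih fun t' ht' => hf t' (by simp [ht']))).congr fun i τ _ => ?_
    rw [Finset.sum_insert ht]

/-- A monomial of degree at least `p` belongs to the remainder, where `O(h^p)` is enough; hence the
`min`. -/
theorem monomial (n : ℕ) {b : ι → G} (hb : UnifBigO h (min n p) (fun i _ => b i)) :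
    HasJet h p (fun i τ => τ ^ n • b i) := by
  rcases lt_or_ge n p with hn | hn
  · rw [min_eq_left hn.le] at hb
    refine ⟨fun i k => if k = n then b i else 0, fun k _ => ?_,
      UnifBigO.zero.congr fun i τ _ => ?_⟩
    · rcases eq_or_ne k n with rfl | hkn
      · simpa using hb
      · simpa [hkn] using UnifBigO.zero
    · simp [hn]
  · rw [min_eq_right hn] at hb
    exact of_unifBigO (hb.pow_smul n)

theorem const (x : G) : HasJet h p (fun _ _ => x) := by
  have := monomial (h := h) (p := p) 0 (b := fun _ => x) (by simpa using UnifBigO.const x)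
  simpa using this

/-- Integration gains one order: a term `s^k` of size `h^k` meets `s^l a` with `a` of size
`h^(l+1)`, producing `τ^(k+l+1)` with a coefficient of size `h^(k+l+1)`. -/
theorem integral_apply [CompleteSpace G] (hh : ∀ i, |h i| ≤ 1) {g : ι → ℝ → E →L[ℝ] G}
    (hg : HasJet h p g) (hgc : ∀ i, Continuous (g i)) (l : ℕ) {a : ι → E}
    (ha : UnifBigO h (min (l + 1) (p + 1)) (fun i _ => a i)) :
    HasJet h (p + 1) (fun i τ => ∫ s in (0 : ℝ)..τ, s ^ l • g i s (a i)) := by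
  obtain ⟨c, hc⟩ := hg
  have hr : UnifBigO h (p + 1) (fun i τ => ∫ s in (0 : ℝ)..τ, s ^ l •
      (g i s - ∑ k ∈ Finset.range p, s ^ k • c i k) (a i)) := by
    refine UnifBigO.integral (((hc.remainder.clm_apply ha).mono hh ?_).pow_smul l)
    omega
  have hm : ∀ k ∈ Finset.range p, HasJet h (p + 1)
      (fun i τ => τ ^ (k + l + 1) • ((1 / ((k + l : ℕ) + 1 : ℝ)) • c i k (a i))) := by
    intro k hk
    refine monomial _ (UnifBigO.const_smul _ ?_)
    refine ((hc.coeff k (by simpa using hk)).clm_apply ha).mono hh ?_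
    omega
  refine ((sum _ hm).add (of_unifBigO hr)).congr fun i τ _ => ?_
  have hgi := hgc i
  have e1 : ∀ k : ℕ, τ ^ (k + l + 1) • ((1 / ((k + l : ℕ) + 1 : ℝ)) • c i k (a i)) =
      ∫ s in (0 : ℝ)..τ, s ^ (k + l) • c i k (a i) := by
    intro k
    rw [intervalIntegral.integral_smul_const, integral_pow, smul_smul]
    congr 1
    simp
    ring
  simp_rw [e1]
  rw [← intervalIntegral.integral_finsetSum
    (fun k _ => Continuous.intervalIntegrable (by fun_prop) _ _),
    ← intervalIntegral.integral_add (Continuous.intervalIntegrable (by fun_prop) _ _)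
      (Continuous.intervalIntegrable (by fun_prop) _ _)]
  refine intervalIntegral.integral_congr fun s _ => ?_
  simp only [sub_apply, sum_apply,
    smul_apply, smul_sub, Finset.smul_sum, smul_smul]
  simp_rw [← pow_add, add_comm l]
  abel

end HasJet

/-- Composition of a `C^p` function with a family of polynomials. -/
theorem hasJet_comp {ι : Type*} {h : ι → ℝ} (hh : ∀ i, |h i| ≤ 1) {E : Type u}
    [NormedAddCommGroup E] [NormedSpace ℝ E] [ProperSpace E] (y₀ : E) (N : ℕ) (a : ι → ℕ → E)
    (p : ℕ) : ∀ {G : Type u} [NormedAddCommGroup G] [NormedSpace ℝ G] [CompleteSpace G]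
    {F : E → G}, ContDiff ℝ p F →
    (∀ l ∈ Finset.range N, UnifBigO h (min (l + 1) p) (fun i _ => a i l)) →
    HasJet h p (fun i τ => F (y₀ + ∑ l ∈ Finset.range N, τ ^ (l + 1) • a i l)) := by
  induction p with
  | zero =>
    intro G _ _ _ F hF ha
    obtain ⟨C, hC⟩ := (UnifBigO.sum (Finset.range N)
      (fun l hl => ((ha l hl).mono hh (Nat.zero_le _)).pow_smul (l + 1))).exists_bound
    obtain ⟨C', hC'⟩ := (isCompact_closedBall y₀ C).exists_bound_of_continuousOn
      hF.continuous.continuousOn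
    refine HasJet.of_unifBigO (UnifBigO.of_bound C' fun i τ hτ => hC' _ ?_)
    rw [mem_closedBall_iff_norm, add_sub_cancel_left]
    exact hC i τ hτ
  -- `F(Y_τ) = F(y₀) + ∫ F'(Y_s) Y'_s ds`, with the induction hypothesis applied to the `C^p` map
  -- `F'`. Its values lie in `E →L[ℝ] G`, so the induction must quantify over `G`.
  | succ p ih =>
    intro G _ _ _ F hF ha
    have hF' : ContDiff ℝ p (fderiv ℝ F) := hF.fderiv_right (by norm_cast)
    have hFd : Differentiable ℝ F := hF.differentiable (by simp)
    have h1 := ih hF' fun l hl => (ha l hl).mono hh (by omega)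
    have hYc : ∀ i, Continuous fun τ : ℝ => y₀ + ∑ l ∈ Finset.range N, τ ^ (l + 1) • a i l :=
      fun i => by fun_prop
    have hgc : ∀ i, Continuous fun τ : ℝ =>
        fderiv ℝ F (y₀ + ∑ l ∈ Finset.range N, τ ^ (l + 1) • a i l) :=
      fun i => hF'.continuous.comp (hYc i)
    have h2 : ∀ l ∈ Finset.range N, HasJet h (p + 1) (fun i τ => ∫ s in (0 : ℝ)..τ, s ^ l •
        fderiv ℝ F (y₀ + ∑ l ∈ Finset.range N, s ^ (l + 1) • a i l)
          (((l : ℝ) + 1) • a i l)) := fun l hl =>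
      HasJet.integral_apply hh h1 hgc l ((ha l hl).const_smul _)
    refine ((HasJet.const (F y₀)).add (HasJet.sum _ h2)).congr fun i τ _ => ?_
    have hd : ∀ τ : ℝ, HasDerivAt
        (fun τ : ℝ => F (y₀ + ∑ l ∈ Finset.range N, τ ^ (l + 1) • a i l))
        (fderiv ℝ F (y₀ + ∑ l ∈ Finset.range N, τ ^ (l + 1) • a i l)
          (∑ l ∈ Finset.range N, (((l + 1 : ℕ) : ℝ) * τ ^ l) • a i l)) τ := by
      intro τ
      refine (hFd _).hasFDerivAt.comp_hasDerivAt τ ?_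
      refine HasDerivAt.const_add _ (HasDerivAt.fun_sum fun l _ => HasDerivAt.smul_const ?_ _)
      simpa using hasDerivAt_pow (l + 1) τ
    have hg := hgc i
    have := intervalIntegral.integral_eq_sub_of_hasDerivAt (a := 0) (b := τ) (fun τ _ => hd τ)
      (Continuous.intervalIntegrable (by fun_prop) _ _)
    simp only [ne_eq, Nat.succ_ne_zero, not_false_eq_true, zero_pow, zero_smul,
      Finset.sum_const_zero, add_zero] at this
    rw [← intervalIntegral.integral_finsetSum
      (fun k _ => Continuous.intervalIntegrable (by fun_prop) _ _), eq_add_of_sub_eq' this.symm]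
    congr 1
    refine intervalIntegral.integral_congr fun s _ => ?_
    simp only [map_sum, map_smul, smul_smul]
    refine Finset.sum_congr rfl fun l _ => ?_
    congr 1
    push_cast
    ring

/-- Separates the terms of a product of truncated expansions that are kept from those of total
degree at least `p`, which are absorbed into the error. -/
theorem sum_range_product_eq {M : Type*} [AddCommMonoid M] (p : ℕ) (f : ℕ → ℕ → M) :
    ∑ b ∈ Finset.range p, ∑ c ∈ Finset.range p, f b c =
      (∑ n ∈ Finset.range p, ∑ x ∈ Finset.HasAntidiagonal.antidiagonal n, f x.1 x.2) +
      ∑ x ∈ (Finset.range p ×ˢ Finset.range p).filter (fun x => p ≤ x.1 + x.2), f x.1 x.2 := by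
  rw [← Finset.sum_product', ← Finset.sum_filter_not_add_sum_filter _ (fun x => p ≤ x.1 + x.2)]
  congr 1
  rw [← Finset.sum_fiberwise_of_maps_to (t := Finset.range p) (g := fun x : ℕ × ℕ => x.1 + x.2)]
  · refine Finset.sum_congr rfl fun n hn => Finset.sum_congr ?_ fun _ _ => rfl
    ext x
    simp only [Finset.mem_filter, Finset.mem_product, Finset.mem_range, not_le,
      Finset.HasAntidiagonal.mem_antidiagonal] at hn ⊢
    omega
  · intro x hx
    simp only [Finset.mem_filter, not_le] at hx
    simpa using hx.2

theorem IsJet.unifBigO (hh : ∀ i, |h i| ≤ 1) {f : ι → ℝ → G} {c : ι → ℕ → G}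
    (hf : IsJet h p f c) : UnifBigO h 0 f := by
  have h1 := UnifBigO.sum (Finset.range p) fun k hk =>
    (((hf.coeff k (by simpa using hk)).mono hh (Nat.zero_le k)).pow_smul k)
  exact ((hf.remainder.mono hh (Nat.zero_le p)).add h1).congr fun i τ _ => by abel

/-- The two factors are evaluated at different points because `θ` is the constant `c_j` in the
method and the identity in the vector field. Both expansions involve the same vectors `a_b(c_k)`, so
they can later be subtracted termwise. -/
theorem IsJet.apply (hh : ∀ i, |h i| ≤ 1) {A : ι → ℝ → E →L[ℝ] G} {x : ι → ℝ → E}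
    {a : ι → ℕ → E →L[ℝ] G} {c : ι → ℕ → E} (hA : IsJet h p A a) (hx : IsJet h p x c)
    {θ : ℝ → ℝ} (hθ : Set.MapsTo θ (Set.Icc (0 : ℝ) 1) (Set.Icc (0 : ℝ) 1)) :
    UnifBigO h p (fun i τ => A i (θ τ) (x i τ) - ∑ n ∈ Finset.range p,
      ∑ b ∈ Finset.HasAntidiagonal.antidiagonal n, (θ τ ^ b.1 * τ ^ b.2) • a i b.1 (c i b.2)) := by
  have h1 := (hA.remainder.comp hθ).clm_apply (hx.unifBigO hh)
  have h2 : UnifBigO h (0 + p) (fun i τ => (∑ k ∈ Finset.range p, θ τ ^ k • a i k)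
      (x i τ - ∑ k ∈ Finset.range p, τ ^ k • c i k)) := by
    refine UnifBigO.clm_apply (UnifBigO.sum _ fun k hk => ?_) hx.remainder
    exact ((UnifBigO.pow k).comp hθ).bdd_smul
      ((hA.coeff k (by simpa using hk)).mono hh (Nat.zero_le k))
  have h3 : UnifBigO h p (fun i τ => ∑ b ∈ (Finset.range p ×ˢ Finset.range p).filter
      (fun b => p ≤ b.1 + b.2), (θ τ ^ b.1 * τ ^ b.2) • a i b.1 (c i b.2)) := by
    refine UnifBigO.sum _ fun b hb => ?_
    simp only [Finset.mem_filter, Finset.mem_product, Finset.mem_range] at hb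
    have hb' := ((hA.coeff b.1 hb.1.1).clm_apply (hx.coeff b.2 hb.1.2)).mono hh hb.2
    refine ((((UnifBigO.pow b.1).comp hθ).bdd_smul (UnifBigO.pow b.2))).bdd_smul hb'
  rw [add_zero] at h1
  rw [zero_add] at h2
  refine ((h1.add h2).add h3).congr fun i τ _ => ?_
  have key : (∑ k ∈ Finset.range p, θ τ ^ k • a i k) (∑ k ∈ Finset.range p, τ ^ k • c i k) =
      ∑ b ∈ Finset.range p, ∑ k ∈ Finset.range p, (θ τ ^ b * τ ^ k) • a i b (c i k) := by
    simp only [map_sum, sum_apply, smul_apply, map_smul,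
      Finset.smul_sum, smul_smul]
    rw [Finset.sum_comm]
    refine Finset.sum_congr rfl fun b _ => Finset.sum_congr rfl fun k _ => ?_
    rw [mul_comm]
  rw [sum_range_product_eq p fun b k => (θ τ ^ b * τ ^ k) • a i b (c i k)] at key
  rw [map_sub, key, sub_apply]
  abel

end Jets

/-! ### Expansion of the defect. -/

namespace PCSRK

variable {ι : Type*} {h : ι → ℝ} {p s : ℕ} {E : Type u} [NormedAddCommGroup E] [NormedSpace ℝ E]

theorem sum_comm_antidiagonal {κ M : Type*} [AddCommMonoid M] (T : Finset κ) (p : ℕ)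
    (F : κ → ℕ × ℕ → M) :
    ∑ t ∈ T, ∑ n ∈ Finset.range p, ∑ b ∈ Finset.HasAntidiagonal.antidiagonal n, F t b =
      ∑ n ∈ Finset.range p, ∑ b ∈ Finset.HasAntidiagonal.antidiagonal n, ∑ t ∈ T, F t b := by
  rw [Finset.sum_comm]
  exact Finset.sum_congr rfl fun n _ => Finset.sum_comm

theorem unifBigO_stageCoeff_sub [CompleteSpace E] (m : PCSRK s) (hh : ∀ i, |h i| ≤ 1)
    {A : ι → ℝ → E →L[ℝ] E} {x : ι → ℝ → E}
    {a : ι → ℕ → E →L[ℝ] E} {c : ι → ℕ → E} (hA : IsJet h p A a) (hx : IsJet h p x c)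
    (hxc : ∀ i, Continuous (x i)) (k : Fin s) :
    UnifBigO h p (fun i _ => m.stageCoeff (fun j ζ => A i (m.c j) (x i ζ)) k -
      ∑ n ∈ Finset.range p, ∑ b ∈ Finset.HasAntidiagonal.antidiagonal n,
        m.nodeMoment k b.1 b.2 • a i b.1 (c i b.2)) := by
  have h1 : ∀ j l : Fin s, UnifBigO h p (fun i _ => m.M j k l • ∫ ζ in (0 : ℝ)..1, ζ ^ (l : ℕ) •
      (A i (m.c j) (x i ζ) - ∑ n ∈ Finset.range p,
      ∑ b ∈ Finset.HasAntidiagonal.antidiagonal n,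
        (m.c j ^ b.1 * ζ ^ b.2) • a i b.1 (c i b.2))) := by
    intro j l
    refine UnifBigO.const_smul _ ?_
    have h2 := hA.apply hh hx (θ := fun _ => m.c j) fun _ _ => m.c_mem j
    exact (h2.pow_smul l).integral.evalAt (t := 1) (by simp)
  refine (UnifBigO.sum Finset.univ fun j _ => UnifBigO.sum Finset.univ fun l _ => h1 j l).congr
    fun i _ _ => ?_
  have hxi := hxc i
  have h3 : ∀ j l : Fin s, (∫ ζ in (0 : ℝ)..1, ζ ^ (l : ℕ) •
      (A i (m.c j) (x i ζ) - ∑ n ∈ Finset.range p,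
      ∑ b ∈ Finset.HasAntidiagonal.antidiagonal n,
        (m.c j ^ b.1 * ζ ^ b.2) • a i b.1 (c i b.2))) =
      (∫ ζ in (0 : ℝ)..1, ζ ^ (l : ℕ) • A i (m.c j) (x i ζ)) -
      ∑ n ∈ Finset.range p, ∑ b ∈ Finset.HasAntidiagonal.antidiagonal n,
        (m.c j ^ b.1 * (1 / ((l : ℕ) + b.2 + 1))) • a i b.1 (c i b.2) := by
    intro j l
    simp_rw [smul_sub, Finset.smul_sum]
    rw [intervalIntegral.integral_sub (Continuous.intervalIntegrable (by fun_prop) _ _)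
      (Continuous.intervalIntegrable (by fun_prop) _ _)]
    congr 1
    rw [intervalIntegral.integral_finsetSum
      (fun k _ => Continuous.intervalIntegrable (by fun_prop) _ _)]
    refine Finset.sum_congr rfl fun n _ => ?_
    rw [intervalIntegral.integral_finsetSum
      (fun k _ => Continuous.intervalIntegrable (by fun_prop) _ _)]
    refine Finset.sum_congr rfl fun b _ => ?_
    simp_rw [smul_smul]
    rw [intervalIntegral.integral_smul_const]
    congr 1
    have : ∀ ζ : ℝ, ζ ^ (l : ℕ) * (m.c j ^ b.1 * ζ ^ b.2) = m.c j ^ b.1 * ζ ^ ((l : ℕ) + b.2) :=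
      fun ζ => by ring
    simp_rw [this]
    rw [intervalIntegral.integral_const_mul, integral_pow]
    simp
  simp_rw [h3, smul_sub, Finset.sum_sub_distrib]
  rw [stageCoeff]
  congr 1
  simp_rw [Finset.smul_sum, sum_comm_antidiagonal]
  refine Finset.sum_congr rfl fun n _ => Finset.sum_congr rfl fun b _ => ?_
  simp_rw [nodeMoment, Finset.mul_sum, Finset.sum_smul]
  refine Finset.sum_congr rfl fun j _ => Finset.sum_congr rfl fun l _ => ?_
  rw [smul_smul]
  congr 1
  ring

/-- The coefficient of `τ^(k+1)` in the stage polynomial is `h v_k / (k+1)`; its factor `h` supplies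
one order, whence `p - 1`. -/
theorem hasJet_comp_stagePoly [ProperSpace E] (hh : ∀ i, |h i| ≤ 1) (y₀ : E)
    {v : ι → Fin s → E} (hv : ∀ k : Fin s, UnifBigO h (min (k : ℕ) (p - 1)) (fun i _ => v i k))
    {G : Type u} [NormedAddCommGroup G] [NormedSpace ℝ G] [CompleteSpace G]
    {F : E → G} (hF : ContDiff ℝ p F) :
    HasJet h p (fun i τ => F (stagePoly y₀ (h i) (v i) τ)) := by
  have h1 := hasJet_comp hh y₀ s
    (fun i l => h i • (1 / ((l : ℝ) + 1)) • if hl : l < s then v i ⟨l, hl⟩ else 0) p hF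
    (fun l hl => by
      have hl' : l < s := by simpa using hl
      have h2 : UnifBigO h (min l (p - 1)) (fun i _ => if hl : l < s then v i ⟨l, hl⟩ else 0) :=
        (hv ⟨l, hl'⟩).congr fun i _ _ => by simp [hl']
      exact (h2.const_smul _).step_smul.mono hh (by omega))
  refine h1.congr fun i τ _ => ?_
  congr 1
  rw [stagePoly, Finset.sum_range, Finset.smul_sum]
  congr 1
  refine Finset.sum_congr rfl fun k _ => ?_
  simp only [Fin.is_lt, dite_true, Fin.eta, smul_smul]
  congr 1
  ring

/-- The defect `∑ τ^k v_k - f(Y_τ)` of the stage polynomial, divided by `h`. -/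
noncomputable def defect (f : E → E) (y₀ : E) (h : ℝ) (v : Fin s → E) (τ : ℝ) : E :=
  ∑ k : Fin s, τ ^ (k : ℕ) • v k - f (stagePoly y₀ h v τ)

/-- The polynomial by which `τ^(b+c)` is missed. -/
noncomputable def defectPoly (m : PCSRK s) (b : ℕ × ℕ) (τ : ℝ) : ℝ :=
  ∑ k : Fin s, τ ^ (k : ℕ) * m.nodeMoment k b.1 b.2 - τ ^ (b.1 + b.2)

theorem continuous_defectPoly (m : PCSRK s) (b : ℕ × ℕ) : Continuous (m.defectPoly b) := by
  unfold defectPoly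
  fun_prop

namespace OrderFourConditions

variable {m : PCSRK 3}

theorem defectPoly_eq_zero (hm : m.OrderFourConditions) {b : ℕ × ℕ} (hb : b.1 + b.2 ≤ 1) :
    m.defectPoly b = 0 := by
  obtain ⟨b, c⟩ := b
  funext τ
  simp only [defectPoly, Pi.zero_apply] at hb ⊢
  rcases b with _ | _ | b
  · rcases c with _ | _ | c
    · simp [hm.moment_zero_zero]
    · simp [hm.moment_zero_one]
    · omega
  · obtain rfl : c = 0 := by omega
    simp [hm.moment_one_zero]
  · omega

theorem integral_defectPoly (hm : m.OrderFourConditions) {b : ℕ × ℕ} (hb : b.1 + b.2 ≤ 3) :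
    ∫ τ in (0 : ℝ)..1, m.defectPoly b τ = 0 := by
  simp only [defectPoly]
  rw [intervalIntegral.integral_sub (Continuous.intervalIntegrable (by fun_prop) _ _)
    (Continuous.intervalIntegrable (by fun_prop) _ _), intervalIntegral.integral_finsetSum
    (fun k _ => Continuous.intervalIntegrable (by fun_prop) _ _)]
  have := hm.integral_eq b.1 b.2 hb
  simp only [intervalIntegral.integral_mul_const, integral_pow, one_pow]
  rw [sub_eq_zero]
  convert this using 1
  · exact Finset.sum_congr rfl fun k _ => by simp; ring
  · simp

theorem integral_mul_defectPoly (hm : m.OrderFourConditions) {b : ℕ × ℕ} (hb : b.1 + b.2 ≤ 2) :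
    ∫ τ in (0 : ℝ)..1, τ * m.defectPoly b τ = 0 := by
  simp only [defectPoly, mul_sub, Finset.mul_sum]
  rw [intervalIntegral.integral_sub (Continuous.intervalIntegrable (by fun_prop) _ _)
    (Continuous.intervalIntegrable (by fun_prop) _ _), intervalIntegral.integral_finsetSum
    (fun k _ => Continuous.intervalIntegrable (by fun_prop) _ _)]
  have := hm.integral_mul_eq b.1 b.2 hb
  simp only [← mul_assoc, ← pow_succ', intervalIntegral.integral_mul_const, integral_pow, one_pow]
  rw [sub_eq_zero]
  convert this using 1
  · refine Finset.sum_congr rfl fun k _ => ?_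
    simp [add_assoc, show (1 : ℝ) + 1 = 2 by norm_num]
    ring
  · simp [add_assoc, show (1 : ℝ) + 1 = 2 by norm_num]

variable [ProperSpace E] {σ : E → E →L[ℝ] E} {ν : E → E} {y₀ : E} {v : ι → Fin 3 → E}

/-- Bootstrap from boundedness. Expansions to order one give `v_k = O(h)` for `k ≥ 1`, since the
moment `(0, 0)` has only a constant term. This permits expansions to order two, whose moments have
no `τ²` coefficient, so `v_2 = O(h²)`. -/
theorem unifBigO_coeff (hm : m.OrderFourConditions) (hh : ∀ i, |h i| ≤ 1) (hσ : ContDiff ℝ 4 σ)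
    (hν : ContDiff ℝ 4 ν) (hv0 : ∀ k, UnifBigO h 0 (fun i _ => v i k))
    (hv : ∀ i k, v i k = m.stageCoeff (fun j ζ => σ (stagePoly y₀ (h i) (v i) (m.c j))
      (ν (stagePoly y₀ (h i) (v i) ζ))) k) (k : Fin 3) :
    UnifBigO h k (fun i _ => v i k) := by
  have hνc : ∀ i, Continuous fun τ => ν (stagePoly y₀ (h i) (v i) τ) :=
    fun i => hν.continuous.comp (continuous_stagePoly _ _ _)
  have h1 : ∀ k : Fin 3, UnifBigO h (min k 1 : ℕ) (fun i _ => v i k) := by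
    intro k
    rcases eq_or_ne k 0 with rfl | hk
    · simpa using hv0 0
    have hv0' : ∀ k : Fin 3, UnifBigO h (min (k : ℕ) (1 - 1)) (fun i _ => v i k) :=
      fun k => by simpa using hv0 k
    obtain ⟨a, ha⟩ := hasJet_comp_stagePoly (p := 1) hh y₀ hv0' (hσ.of_le (by norm_num))
    obtain ⟨c, hc⟩ := hasJet_comp_stagePoly (p := 1) hh y₀ hv0' (hν.of_le (by norm_num))
    have h2 := m.unifBigO_stageCoeff_sub hh ha hc hνc k
    simp_rw [← hv] at h2
    simp [hm.moment_zero_zero, hk] at h2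
    exact h2.mono hh (min_le_right _ _)
  have h2 : UnifBigO h 2 (fun i _ => v i 2) := by
    obtain ⟨a, ha⟩ := hasJet_comp_stagePoly (p := 2) hh y₀ h1 (hσ.of_le (by norm_num))
    obtain ⟨c, hc⟩ := hasJet_comp_stagePoly (p := 2) hh y₀ h1 (hν.of_le (by norm_num))
    have h2 := m.unifBigO_stageCoeff_sub hh ha hc hνc 2
    simp_rw [← hv] at h2
    simpa [hm.moment_zero_zero, hm.moment_zero_one, hm.moment_one_zero, Finset.sum_range_succ,
      Finset.Nat.antidiagonal_succ] using h2
  fin_cases k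
  · exact hv0 0
  · simpa using h1 1
  · exact h2

theorem exists_defect_expansion (hm : m.OrderFourConditions) (hh : ∀ i, |h i| ≤ 1)
    (hσ : ContDiff ℝ 4 σ) (hν : ContDiff ℝ 4 ν) (hv0 : ∀ k, UnifBigO h 0 (fun i _ => v i k))
    (hv : ∀ i k, v i k = m.stageCoeff (fun j ζ => σ (stagePoly y₀ (h i) (v i) (m.c j))
      (ν (stagePoly y₀ (h i) (v i) ζ))) k) :
    ∃ w : ι → ℕ × ℕ → E, (∀ n < 4, ∀ b ∈ Finset.HasAntidiagonal.antidiagonal n,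
        UnifBigO h n (fun i _ => w i b)) ∧
      UnifBigO h 4 (fun i τ => defect (fun x => σ x (ν x)) y₀ (h i) (v i) τ -
        ∑ n ∈ Finset.range 4, ∑ b ∈ Finset.HasAntidiagonal.antidiagonal n,
          m.defectPoly b τ • w i b) := by
  have hνc : ∀ i, Continuous fun τ => ν (stagePoly y₀ (h i) (v i) τ) :=
    fun i => hν.continuous.comp (continuous_stagePoly _ _ _)
  have h1 : ∀ k : Fin 3, UnifBigO h (min k (4 - 1) : ℕ) (fun i _ => v i k) := by
    intro k
    rw [min_eq_left (by omega)]
    exact hm.unifBigO_coeff hh hσ hν hv0 hv k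
  obtain ⟨a, ha⟩ := hasJet_comp_stagePoly (p := 4) hh y₀ h1 hσ
  obtain ⟨c, hc⟩ := hasJet_comp_stagePoly (p := 4) hh y₀ h1 hν
  refine ⟨fun i b => a i b.1 (c i b.2), fun n hn b hb => ?_, ?_⟩
  · rw [Finset.HasAntidiagonal.mem_antidiagonal] at hb
    subst hb
    exact (ha.coeff b.1 (by omega)).clm_apply (hc.coeff b.2 (by omega))
  · have h2 := fun k => (m.unifBigO_stageCoeff_sub hh ha hc hνc k).pow_smul (k : ℕ)
    simp_rw [← hv] at h2
    have h3 := ha.apply hh hc (θ := id) (Set.mapsTo_id _)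
    refine ((UnifBigO.sum Finset.univ fun k _ => h2 k).sub h3).congr fun i τ _ => ?_
    have h4 : ∀ b : ℕ × ℕ, m.defectPoly b τ • a i b.1 (c i b.2) =
        ∑ k : Fin 3, τ ^ (k : ℕ) • m.nodeMoment k b.1 b.2 • a i b.1 (c i b.2) -
          (τ ^ b.1 * τ ^ b.2) • a i b.1 (c i b.2) := by
      intro b
      simp only [defectPoly, sub_smul, Finset.sum_smul, mul_smul, ← pow_add]
    simp only [h4, Finset.sum_sub_distrib, defect, smul_sub, id]
    have h5 : ∑ n ∈ Finset.range 4, ∑ b ∈ Finset.HasAntidiagonal.antidiagonal n,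
        ∑ k : Fin 3, τ ^ (k : ℕ) • m.nodeMoment k b.1 b.2 • a i b.1 (c i b.2) =
        ∑ k : Fin 3, τ ^ (k : ℕ) • ∑ n ∈ Finset.range 4,
          ∑ b ∈ Finset.HasAntidiagonal.antidiagonal n,
            m.nodeMoment k b.1 b.2 • a i b.1 (c i b.2) := by
      simp_rw [Finset.smul_sum, sum_comm_antidiagonal]
    rw [h5]
    abel

end OrderFourConditions

end PCSRK

/-! ### Estimate of the local error. -/

theorem exists_norm_sub_le_of_contDiff {E G : Type*} [NormedAddCommGroup E] [NormedSpace ℝ E]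
    [ProperSpace E] [NormedAddCommGroup G] [NormedSpace ℝ G] {f : E → G} (hf : ContDiff ℝ 1 f)
    (y₀ : E) (r : ℝ) : ∃ L : ℝ, 0 ≤ L ∧ ∀ x ∈ Metric.closedBall y₀ r,
      ∀ y ∈ Metric.closedBall y₀ r, ‖f x - f y‖ ≤ L * ‖x - y‖ := by
  obtain ⟨L, hL⟩ := (isCompact_closedBall y₀ r).exists_bound_of_continuousOn
    (hf.continuous_fderiv (by simp)).continuousOn
  refine ⟨|L|, abs_nonneg L, fun x hx y hy => ?_⟩
  exact (convex_closedBall y₀ r).norm_image_sub_le_of_norm_fderiv_le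
    (fun z _ => (hf.differentiable (by simp)) z) (fun z hz => (hL z hz).trans (le_abs_self L)) hy hx

namespace PCSRK

variable {ι : Type*} {h : ι → ℝ} {s : ℕ} {E : Type u} [NormedAddCommGroup E] [NormedSpace ℝ E]

theorem unifBigO_stagePoly_sub (y₀ : E) {v : ι → Fin s → E}
    (hv : ∀ k, UnifBigO h 0 (fun i _ => v i k)) :
    UnifBigO h 1 (fun i τ => stagePoly y₀ (h i) (v i) τ - y₀) := by
  have h1 : ∀ k : Fin s, UnifBigO h 0
      (fun i τ => τ ^ ((k : ℕ) + 1) • (1 / (((k : ℕ) : ℝ) + 1)) • v i k) :=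
    fun k => ((hv k).const_smul _).pow_smul _
  refine (UnifBigO.sum Finset.univ fun k _ => h1 k).step_smul.congr fun i τ _ => ?_
  rw [stagePoly, add_sub_cancel_left]
  simp only [smul_smul, mul_one_div]

theorem continuous_defect {f : E → E} (hf : Continuous f) (y₀ : E) (h : ℝ) (v : Fin s → E) :
    Continuous (defect f y₀ h v) :=
  (continuous_finsetSum _ fun _ _ => (continuous_pow _).smul continuous_const).sub
    (hf.comp (continuous_stagePoly y₀ h v))

namespace OrderFourConditions

variable {m : PCSRK 3} [ProperSpace E] {σ : E → E →L[ℝ] E} {ν : E → E} {y₀ : E}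
  {v : ι → Fin 3 → E}

/-- In each of the three estimates the moment conditions kill the terms of degree below `2`, `4` and
`3` respectively; the others are small enough by the size of their coefficients. -/
theorem unifBigO_defect (hm : m.OrderFourConditions) (hh : ∀ i, |h i| ≤ 1)
    (hσ : ContDiff ℝ 4 σ) (hν : ContDiff ℝ 4 ν) (hv0 : ∀ k, UnifBigO h 0 (fun i _ => v i k))
    (hv : ∀ i k, v i k = m.stageCoeff (fun j ζ => σ (stagePoly y₀ (h i) (v i) (m.c j))
      (ν (stagePoly y₀ (h i) (v i) ζ))) k) :
    UnifBigO h 2 (fun i τ => defect (fun x => σ x (ν x)) y₀ (h i) (v i) τ) ∧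
    UnifBigO h 4 (fun i _ => ∫ τ in (0 : ℝ)..1,
      defect (fun x => σ x (ν x)) y₀ (h i) (v i) τ) ∧
    UnifBigO h 3 (fun i _ => ∫ τ in (0 : ℝ)..1,
      (1 - τ) • defect (fun x => σ x (ν x)) y₀ (h i) (v i) τ) := by
  obtain ⟨w, hw, hD⟩ := hm.exists_defect_expansion hh hσ hν hv0 hv
  have hDc : ∀ i, Continuous fun τ => defect (fun x => σ x (ν x)) y₀ (h i) (v i) τ :=
    fun i => continuous_defect (hσ.continuous.clm_apply hν.continuous) _ _ _
  have hqc := fun b => m.continuous_defectPoly b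
  have hqb : ∀ b, UnifBigO h 0 (fun _ τ => m.defectPoly b τ) := by
    intro b
    obtain ⟨C, hC⟩ := isCompact_Icc.exists_bound_of_continuousOn (hqc b).continuousOn
    exact UnifBigO.of_bound C fun _ τ hτ => hC τ hτ
  refine ⟨?_, ?_, ?_⟩
  · have h1 : UnifBigO h 2 (fun i τ => ∑ n ∈ Finset.range 4,
        ∑ b ∈ Finset.HasAntidiagonal.antidiagonal n, m.defectPoly b τ • w i b) := by
      refine UnifBigO.sum _ fun n hn => UnifBigO.sum _ fun b hb => ?_
      rcases Nat.lt_or_ge n 2 with hn2 | hn2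
      · rw [Finset.HasAntidiagonal.mem_antidiagonal] at hb
        rw [hm.defectPoly_eq_zero (b := b) (by omega)]
        simpa using UnifBigO.zero
      · exact (hqb b).bdd_smul ((hw n (by simpa using hn) b hb).mono hh hn2)
    exact ((hD.mono hh (by norm_num)).add h1).congr fun i τ _ => by abel
  · refine (hD.integral.evalAt (t := 1) (by simp)).congr fun i _ _ => ?_
    rw [intervalIntegral.integral_sub ((hDc i).intervalIntegrable _ _)
      (Continuous.intervalIntegrable (by fun_prop) _ _)]
    rw [eq_comm, sub_eq_self, intervalIntegral.integral_finsetSum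
      (fun k _ => Continuous.intervalIntegrable (by fun_prop) _ _)]
    refine Finset.sum_eq_zero fun n hn => ?_
    rw [intervalIntegral.integral_finsetSum
      (fun k _ => Continuous.intervalIntegrable (by fun_prop) _ _)]
    refine Finset.sum_eq_zero fun b hb => ?_
    rw [Finset.HasAntidiagonal.mem_antidiagonal] at hb
    have hn' : n < 4 := by simpa using hn
    rw [intervalIntegral.integral_smul_const, hm.integral_defectPoly (by omega), zero_smul]
  · have hφ : UnifBigO h 0 (fun _ τ => 1 - τ) :=
      UnifBigO.of_bound 1 fun _ τ hτ => by
        rw [Real.norm_eq_abs, abs_le]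
        constructor <;> linarith [hτ.1, hτ.2]
    -- The terms of degree three need no cancellation here: their coefficients are already `O(h³)`.
    have h3 : UnifBigO h 3 (fun i _ => ∑ b ∈ Finset.HasAntidiagonal.antidiagonal 3,
        ∫ τ in (0 : ℝ)..1, (1 - τ) • m.defectPoly b τ • w i b) := by
      refine UnifBigO.sum _ fun b hb => ?_
      exact (hφ.bdd_smul ((hqb b).bdd_smul (hw 3 (by norm_num) b hb))).integral.evalAt
        (t := 1) (by simp)
    refine (((hφ.bdd_smul hD).integral.evalAt (t := 1) (by simp)).mono hh
      (by norm_num : 3 ≤ 4) |>.add h3).congr fun i _ _ => ?_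
    have hDi := hDc i
    simp_rw [smul_sub]
    rw [intervalIntegral.integral_sub (Continuous.intervalIntegrable (by fun_prop) _ _)
      (Continuous.intervalIntegrable (by fun_prop) _ _)]
    rw [eq_comm, sub_add, sub_eq_self, sub_eq_zero]
    simp_rw [Finset.smul_sum]
    rw [intervalIntegral.integral_finsetSum
      (fun k _ => Continuous.intervalIntegrable (by fun_prop) _ _), Finset.sum_range_succ]
    rw [intervalIntegral.integral_finsetSum (s := Finset.HasAntidiagonal.antidiagonal 3)
      (fun k _ => Continuous.intervalIntegrable (by fun_prop) _ _)]
    rw [add_eq_right]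
    refine Finset.sum_eq_zero fun n hn => ?_
    rw [intervalIntegral.integral_finsetSum
      (fun k _ => Continuous.intervalIntegrable (by fun_prop) _ _)]
    refine Finset.sum_eq_zero fun b hb => ?_
    rw [Finset.HasAntidiagonal.mem_antidiagonal] at hb
    have hn' : n < 3 := by simpa using hn
    simp_rw [smul_smul]
    rw [intervalIntegral.integral_smul_const]
    simp_rw [sub_mul, one_mul]
    rw [intervalIntegral.integral_sub (Continuous.intervalIntegrable (by fun_prop) _ _)
      (Continuous.intervalIntegrable (by fun_prop) _ _), hm.integral_defectPoly (by omega),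
      hm.integral_mul_defectPoly (by omega), sub_zero, zero_smul]

/-- The local error of a family of steps whose stages stay in a ball. -/
theorem unifBigO_localError (hm : m.OrderFourConditions) (hh : ∀ i, |h i| ≤ 1)
    (hσ : ContDiff ℝ 4 σ) (hν : ContDiff ℝ 4 ν) (hv0 : ∀ k, UnifBigO h 0 (fun i _ => v i k))
    (hv : ∀ i k, v i k = m.stageCoeff (fun j ζ => σ (stagePoly y₀ (h i) (v i) (m.c j))
      (ν (stagePoly y₀ (h i) (v i) ζ))) k) {r : ℝ}
    (hY : ∀ i, ∀ τ ∈ Set.Icc (0 : ℝ) 1, ‖stagePoly y₀ (h i) (v i) τ - y₀‖ ≤ r)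
    {y : ℝ → E} (hy0 : y 0 = y₀)
    (hy : ∀ i, ∀ τ ∈ Set.Icc (0 : ℝ) 1, HasDerivAt y (σ (y (h i * τ)) (ν (y (h i * τ)))) (h i * τ))
    (hyr : ∀ i, ∀ τ ∈ Set.Icc (0 : ℝ) 1, ‖y (h i * τ) - y₀‖ ≤ r) :
    UnifBigO h 5 (fun i _ => stagePoly y₀ (h i) (v i) 1 - y (h i)) := by
  set f : E → E := fun x => σ x (ν x) with hf
  obtain ⟨hD2, hD4, hD3⟩ := hm.unifBigO_defect hh hσ hν hv0 hv
  rw [← hf] at hD2 hD4 hD3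
  have hfC : ContDiff ℝ 4 f := hσ.clm_apply hν
  have hfc : Continuous f := hfC.continuous
  set Y : ι → ℝ → E := fun i τ => stagePoly y₀ (h i) (v i) τ with hYdef
  set D : ι → ℝ → E := fun i τ => defect f y₀ (h i) (v i) τ with hDdef
  set U : ι → ℝ → E := fun i τ => f (Y i τ) - f (y (h i * τ)) with hU
  set e : ι → ℝ → E := fun i τ => Y i τ - y (h i * τ) with he
  have hYc : ∀ i, Continuous (Y i) := fun i => continuous_stagePoly _ _ _
  have hDc : ∀ i, Continuous (D i) := fun i => continuous_defect hfc _ _ _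
  have hed : ∀ i, ∀ τ ∈ Set.Icc (0 : ℝ) 1, HasDerivAt (e i) (h i • (D i τ + U i τ)) τ := by
    intro i τ hτ
    have h1 := hasDerivAt_stagePoly y₀ (h i) (v i) τ
    have h2 : HasDerivAt (fun τ => y (h i * τ)) (h i • f (y (h i * τ))) τ := by
      have h3 : HasDerivAt (fun τ : ℝ => h i * τ) (h i) τ := by
        simpa using (hasDerivAt_id τ).const_mul (h i)
      exact (hy i τ hτ).scomp τ h3
    refine (h1.sub h2).congr_deriv ?_
    simp only [hDdef, hU, defect, hYdef, ← smul_sub]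
    congr 1
    abel
  have hec : ∀ i, ContinuousOn (e i) (Set.Icc 0 1) :=
    fun i τ hτ => (hed i τ hτ).continuousAt.continuousWithinAt
  have hUc : ∀ i, ContinuousOn (U i) (Set.Icc 0 1) := by
    intro i
    have h1 : ContinuousOn (fun τ => y (h i * τ)) (Set.Icc 0 1) := by
      refine ((hYc i).continuousOn.sub (hec i)).congr fun τ _ => ?_
      simp [he]
    exact (hfc.comp (hYc i)).continuousOn.sub (hfc.comp_continuousOn h1)
  have hintegrable : ∀ {g : ℝ → E}, ContinuousOn g (Set.Icc 0 1) → ∀ τ ∈ Set.Icc (0 : ℝ) 1,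
      IntervalIntegrable g MeasureTheory.volume 0 τ := fun hg τ hτ =>
    (hg.mono (Set.Icc_subset_Icc_right hτ.2)).intervalIntegrable_of_Icc hτ.1
  have hDUc : ∀ i, ContinuousOn (fun τ => h i • (D i τ + U i τ)) (Set.Icc 0 1) :=
    fun i => ((hDc i).continuousOn.add (hUc i)).const_smul (h i)
  have he0 : ∀ i, e i 0 = 0 := fun i => by simp [he, hYdef, stagePoly_zero, hy0]
  have hem : ∀ i, ∀ τ ∈ Set.Icc (0 : ℝ) 1,
      e i τ = h i • ∫ t in (0 : ℝ)..τ, (D i t + U i t) := by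
    intro i τ hτ
    have hd : ∀ t ∈ Set.uIcc 0 τ, HasDerivAt (e i) (h i • (D i t + U i t)) t := fun t ht => by
      rw [Set.uIcc_of_le hτ.1] at ht
      exact hed i t ⟨ht.1, ht.2.trans hτ.2⟩
    rw [← intervalIntegral.integral_smul, intervalIntegral.integral_eq_sub_of_hasDerivAt hd
      (hintegrable (hDUc i) τ hτ), he0, sub_zero]
  obtain ⟨L, -, hL⟩ := exists_norm_sub_le_of_contDiff (hfC.of_le (by norm_num)) y₀ r
  have hUe : ∀ q, UnifBigO h q e → UnifBigO h q U := fun q hq =>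
    hq.of_norm_le L fun i τ hτ => hL _ (mem_closedBall_iff_norm.2 (hY i τ hτ)) _
      (mem_closedBall_iff_norm.2 (hyr i τ hτ))
  -- Each pass through the integral equation gains a factor `h`, until the bound `D = O(h²)` stops
  -- the gain at `e = O(h³)`. No Gronwall inequality is needed, since `e` is bounded a priori.
  have heU : ∀ q ≤ 2, UnifBigO h q U → UnifBigO h (q + 1) e := fun q hq hUq =>
    ((hD2.mono hh hq).add hUq).integral.step_smul.congr fun i τ hτ => hem i τ hτ
  have e0 : UnifBigO h 0 e := UnifBigO.of_bound (r + r) fun i τ hτ => by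
    rw [show e i τ = (Y i τ - y₀) - (y (h i * τ) - y₀) by simp [he]]
    exact (norm_sub_le _ _).trans (add_le_add (hY i τ hτ) (hyr i τ hτ))
  have e1 := heU 0 (by norm_num) (hUe 0 e0)
  have e2 := heU 1 (by norm_num) (hUe 1 e1)
  have e3 : UnifBigO h 3 e := heU 2 (by norm_num) (hUe 2 e2)
  have U3 := hUe 3 e3
  set J := fderiv ℝ f y₀ with hJ
  have hYy : UnifBigO h 1 (fun i τ => Y i τ - y₀) := unifBigO_stagePoly_sub y₀ hv0
  have hyy : UnifBigO h 1 (fun i τ => y (h i * τ) - y₀) :=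
    (hYy.sub e1).congr fun i τ _ => by simp [he]
  have R4 : UnifBigO h 4 (fun i τ => U i τ - J (e i τ)) := by
    obtain ⟨K, hK0, hK⟩ := exists_norm_sub_le_of_contDiff (f := fderiv ℝ f)
      (hfC.fderiv_right (by norm_num)) y₀ r
    have h1 : UnifBigO h 1 (fun i τ => ‖Y i τ - y₀‖ + ‖y (h i * τ) - y₀‖) :=
      (hYy.of_norm_le 1 fun i τ _ => by simp).add (hyy.of_norm_le 1 fun i τ _ => by simp)
    refine (h1.smul e3).of_norm_le K fun i τ hτ => ?_
    -- The mean value inequality is used on a ball of radius `ρ = O(h)` rather than `r`, so that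
    -- `f'` differs from `J` by `O(h)` there; with `e = O(h³)` this makes the linearisation error
    -- `O(h⁴)`.
    set ρ := max ‖Y i τ - y₀‖ ‖y (h i * τ) - y₀‖ with hρ
    have hρr : ρ ≤ r := max_le (hY i τ hτ) (hyr i τ hτ)
    have h2 := (convex_closedBall y₀ ρ).norm_image_sub_le_of_norm_fderiv_le' (f := f) (φ := J)
      (C := K * ρ) (x := y (h i * τ)) (y := Y i τ)
      (fun z _ => (hfC.differentiable (by simp)) z) (fun z hz => by
        have hz' : ‖z - y₀‖ ≤ ρ := mem_closedBall_iff_norm.1 hz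
        exact (hK z (mem_closedBall_iff_norm.2 (hz'.trans hρr)) y₀
          (Metric.mem_closedBall_self ((norm_nonneg _).trans (hY i τ hτ)))).trans
            (mul_le_mul_of_nonneg_left hz' hK0))
      (mem_closedBall_iff_norm.2 (le_max_right _ _)) (mem_closedBall_iff_norm.2 (le_max_left _ _))
    refine h2.trans ?_
    rw [norm_smul, mul_assoc]
    refine mul_le_mul_of_nonneg_left (mul_le_mul_of_nonneg_right ?_ (norm_nonneg _)) hK0
    exact (max_le_add_of_nonneg (norm_nonneg _) (norm_nonneg _)).trans (le_abs_self _)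
  -- Integration by parts against `1 - τ`, using `e(0) = 0`, gives `∫ e = h ∫ (1 - τ)(D + U)`, one
  -- order better than the pointwise bound.
  have he4 : UnifBigO h 4 (fun i _ => ∫ τ in (0 : ℝ)..1, e i τ) := by
    have hφ : UnifBigO h 0 (fun _ τ => 1 - τ) :=
      UnifBigO.of_bound 1 fun _ τ hτ => by
        rw [Real.norm_eq_abs, abs_le]
        constructor <;> linarith [hτ.1, hτ.2]
    refine (hD3.add ((hφ.bdd_smul U3).integral.evalAt (t := 1) (by simp))).step_smul.congr
      fun i _ _ => ?_
    have hφc : ContinuousOn (fun τ : ℝ => 1 - τ) (Set.Icc 0 1) := by fun_prop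
    have hφDU : ContinuousOn (fun τ => (1 - τ) • (h i • (D i τ + U i τ))) (Set.Icc 0 1) :=
      hφc.smul (hDUc i)
    have hφD : ContinuousOn (fun τ => (1 - τ) • D i τ) (Set.Icc 0 1) :=
      hφc.smul (hDc i).continuousOn
    have hφU : ContinuousOn (fun τ => (1 - τ) • U i τ) (Set.Icc 0 1) := hφc.smul (hUc i)
    have hne : ContinuousOn (fun τ => (-1 : ℝ) • e i τ) (Set.Icc 0 1) := (hec i).const_smul _
    have hd : ∀ t ∈ Set.uIcc (0 : ℝ) 1, HasDerivAt (fun τ => (1 - τ) • e i τ)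
        ((1 - t) • (h i • (D i t + U i t)) + (-1 : ℝ) • e i t) t := fun t ht => by
      rw [Set.uIcc_of_le zero_le_one] at ht
      exact ((hasDerivAt_id t).const_sub 1).smul (hed i t ht)
    have h1 := intervalIntegral.integral_eq_sub_of_hasDerivAt hd
      (hintegrable (hφDU.add hne) 1 (by simp))
    rw [intervalIntegral.integral_add (hintegrable hφDU 1 (by simp))
        (hintegrable hne 1 (by simp)),
      intervalIntegral.integral_smul (-1 : ℝ), he0, sub_self, zero_smul, smul_zero, sub_zero,
      neg_one_smul, ← sub_eq_add_neg, sub_eq_zero] at h1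
    rw [← h1, ← intervalIntegral.integral_add (hintegrable hφD 1 (by simp))
        (hintegrable hφU 1 (by simp)),
      ← intervalIntegral.integral_smul]
    refine intervalIntegral.integral_congr fun τ _ => ?_
    simp only [smul_add, smul_comm (h i)]
  have hJ0 : UnifBigO h 0 (fun _ _ => J) := UnifBigO.const J
  have hfin := ((hD4.add (by simpa using hJ0.clm_apply he4)).add
    (R4.integral.evalAt (t := 1) (by simp))).step_smul
  refine hfin.congr fun i _ _ => ?_
  have h1 : stagePoly y₀ (h i) (v i) 1 - y (h i) = e i 1 := by simp [he, hYdef]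
  rw [h1, hem i 1 (by simp)]
  congr 1
  have hJe : ContinuousOn (fun τ => J (e i τ)) (Set.Icc 0 1) :=
    J.continuous.comp_continuousOn (hec i)
  have hDJe : ContinuousOn (fun τ => D i τ + J (e i τ)) (Set.Icc 0 1) :=
    (hDc i).continuousOn.add hJe
  have hUJe : ContinuousOn (fun τ => U i τ - J (e i τ)) (Set.Icc 0 1) := (hUc i).sub hJe
  rw [← J.intervalIntegral_comp_comm (hintegrable (hec i) 1 (by simp)),
    ← intervalIntegral.integral_add (hintegrable (hDc i).continuousOn 1 (by simp))
      (hintegrable hJe 1 (by simp)),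
    ← intervalIntegral.integral_add (hintegrable hDJe 1 (by simp)) (hintegrable hUJe 1 (by simp))]
  refine intervalIntegral.integral_congr fun τ _ => ?_
  abel

end OrderFourConditions

end PCSRK

/-! ### Existence and local uniqueness of the step. -/

namespace PCSRK

variable {s : ℕ} {E : Type*} [NormedAddCommGroup E] [NormedSpace ℝ E]

theorem stageCoeff_sub (m : PCSRK s) {g g' : Fin s → ℝ → E} (hg : ∀ j, Continuous (g j))
    (hg' : ∀ j, Continuous (g' j)) (k : Fin s) :
    m.stageCoeff g k - m.stageCoeff g' k = m.stageCoeff (fun j ζ => g j ζ - g' j ζ) k := by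
  simp only [stageCoeff, ← Finset.sum_sub_distrib, ← smul_sub]
  refine Finset.sum_congr rfl fun j _ => Finset.sum_congr rfl fun l _ => ?_
  have h1 := hg j
  have h2 := hg' j
  simp_rw [smul_sub]
  rw [intervalIntegral.integral_sub (Continuous.intervalIntegrable (by fun_prop) _ _)
    (Continuous.intervalIntegrable (by fun_prop) _ _), smul_sub]

theorem exists_norm_stageCoeff_le (m : PCSRK s) : ∃ Λ : ℝ, 0 ≤ Λ ∧
    ∀ (g : Fin s → ℝ → E) (B : ℝ), (∀ j, ∀ ζ ∈ Set.Icc (0 : ℝ) 1, ‖g j ζ‖ ≤ B) → 0 ≤ B →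
      ‖m.stageCoeff g‖ ≤ Λ * B := by
  refine ⟨∑ k, ∑ j, ∑ l, |m.M j k l|, by positivity, fun g B hg hB => ?_⟩
  refine (pi_norm_le_iff_of_nonneg (by positivity)).2 fun k => ?_
  have h1 : ‖m.stageCoeff g k‖ ≤ (∑ j, ∑ l, |m.M j k l|) * B := by
    simp only [Finset.sum_mul]
    refine norm_sum_le_of_le _ fun j _ => norm_sum_le_of_le _ fun l _ => ?_
    rw [norm_smul, Real.norm_eq_abs]
    refine mul_le_mul_of_nonneg_left ?_ (abs_nonneg _)
    have h2 := intervalIntegral.norm_integral_le_of_norm_le_const (a := 0) (b := 1) (C := B)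
      (f := fun ζ => ζ ^ (l : ℕ) • g j ζ) fun ζ hζ => by
        rw [Set.uIoc_of_le zero_le_one] at hζ
        rw [norm_smul, norm_pow, Real.norm_eq_abs, abs_of_nonneg hζ.1.le]
        exact (mul_le_of_le_one_left (norm_nonneg _) (pow_le_one₀ hζ.1.le hζ.2)).trans
          (hg j ζ ⟨hζ.1.le, hζ.2⟩)
    simpa using h2
  refine h1.trans (mul_le_mul_of_nonneg_right ?_ hB)
  exact Finset.single_le_sum (f := fun k => ∑ j, ∑ l, |m.M j k l|)
    (fun k _ => by positivity) (Finset.mem_univ k)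

theorem norm_stagePoly_sub_stagePoly_le (y₀ : E) (h : ℝ) (v w : Fin s → E) {τ : ℝ}
    (hτ : τ ∈ Set.Icc (0 : ℝ) 1) :
    ‖stagePoly y₀ h v τ - stagePoly y₀ h w τ‖ ≤ |h| * (s * ‖v - w‖) := by
  have h1 : stagePoly y₀ h v τ - stagePoly y₀ h w τ =
      h • ∑ k : Fin s, (τ ^ ((k : ℕ) + 1) / (((k : ℕ) : ℝ) + 1)) • (v - w) k := by
    simp only [stagePoly, Pi.sub_apply, smul_sub, Finset.sum_sub_distrib]
    abel
  rw [h1, norm_smul, Real.norm_eq_abs]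
  refine mul_le_mul_of_nonneg_left ?_ (abs_nonneg h)
  refine (norm_sum_le_of_le (f := fun k : Fin s => (τ ^ ((k : ℕ) + 1) / (((k : ℕ) : ℝ) + 1)) •
    (v - w) k) (n := fun _ => ‖v - w‖) Finset.univ fun k _ => ?_).trans (by simp)
  rw [norm_smul]
  refine (mul_le_of_le_one_left (norm_nonneg _) ?_).trans (norm_le_pi_norm (v - w) k)
  have h2 := hτ.1
  rw [Real.norm_eq_abs, abs_of_nonneg (by positivity), div_le_one (by positivity)]
  exact (pow_le_one₀ hτ.1 hτ.2).trans (by simp)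

theorem norm_stagePoly_sub_le (y₀ : E) (h : ℝ) (v : Fin s → E) {τ : ℝ}
    (hτ : τ ∈ Set.Icc (0 : ℝ) 1) : ‖stagePoly y₀ h v τ - y₀‖ ≤ |h| * (s * ‖v‖) := by
  have := norm_stagePoly_sub_stagePoly_le y₀ h v 0 hτ
  simpa [stagePoly] using this

/-- The coefficients `v` of the stage polynomial satisfy the equations of a step of size `h`, and
the stages stay in the ball of radius `r`. -/
def IsStageSolution (m : PCSRK s) (g : E → E → E) (y₀ : E) (r h : ℝ) (v : Fin s → E) : Prop :=
  (∀ k, v k = m.stageCoeff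
    (fun j ζ => g (stagePoly y₀ h v (m.c j)) (stagePoly y₀ h v ζ)) k) ∧
  ∀ τ ∈ Set.Icc (0 : ℝ) 1, ‖stagePoly y₀ h v τ - y₀‖ ≤ r

/-- The bound does not depend on `h` or `v`: it gives both an invariant ball for the fixed-point map
and an a priori bound for every solution with stages near `y₀`. -/
theorem exists_norm_stageCoeff_stagePoly_le [ProperSpace E] (m : PCSRK s) {g : E → E → E}
    (hg : Continuous (Function.uncurry g)) (y₀ : E) (r : ℝ) :
    ∃ V : ℝ, 0 ≤ V ∧ ∀ (h : ℝ) (v : Fin s → E), (∀ τ ∈ Set.Icc (0 : ℝ) 1, ‖stagePoly y₀ h v τ - y₀‖ ≤ r) →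
      ‖m.stageCoeff (fun j ζ => g (stagePoly y₀ h v (m.c j)) (stagePoly y₀ h v ζ))‖ ≤ V := by
  obtain ⟨Λ, hΛ0, hΛ⟩ := m.exists_norm_stageCoeff_le (E := E)
  obtain ⟨B, hB⟩ := ((isCompact_closedBall y₀ r).prod
    (isCompact_closedBall y₀ r)).exists_bound_of_continuousOn hg.continuousOn
  refine ⟨Λ * |B|, by positivity, fun h v hv => hΛ _ _ (fun j ζ hζ => ?_) (abs_nonneg B)⟩
  refine le_trans ?_ (le_abs_self B)
  exact hB (_, _) ⟨mem_closedBall_iff_norm.2 (hv _ (m.c_mem j)),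
    mem_closedBall_iff_norm.2 (hv _ hζ)⟩

theorem existsUnique_isStageSolution [ProperSpace E] (m : PCSRK s) {g : E → E → E}
    (hg : ContDiff ℝ 1 (Function.uncurry g)) (y₀ : E) {r : ℝ} (hr : 0 < r) :
    ∃ h₀ > (0 : ℝ), ∀ h : ℝ, |h| ≤ h₀ → ∃! v, m.IsStageSolution g y₀ r h v := by
  obtain ⟨V, hV0, hV⟩ := m.exists_norm_stageCoeff_stagePoly_le hg.continuous y₀ r
  obtain ⟨Λ, hΛ0, hΛ⟩ := m.exists_norm_stageCoeff_le (E := E)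
  obtain ⟨L, hL0, hL⟩ := exists_norm_sub_le_of_contDiff hg (y₀, y₀) r
  -- The first bound on `|h|` keeps the stages in the `r`-ball when `‖v‖ ≤ V`; the second makes the
  -- Lipschitz constant at most `1/2`. The summands `+ 1` avoid division by zero.
  refine ⟨min (r / (s * V + 1)) (1 / (2 * (Λ * L * s + 1))), by positivity, fun h hh => ?_⟩
  set Ψ : (Fin s → E) → Fin s → E := fun v =>
    m.stageCoeff (fun j ζ => g (stagePoly y₀ h v (m.c j)) (stagePoly y₀ h v ζ)) with hΨ
  have hball : ∀ v : Fin s → E, ‖v‖ ≤ V → ∀ τ ∈ Set.Icc (0 : ℝ) 1,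
      ‖stagePoly y₀ h v τ - y₀‖ ≤ r := by
    intro v hv τ hτ
    have h1 : |h| * (s * V + 1) ≤ r :=
      (le_div_iff₀ (by positivity)).1 (hh.trans (min_le_left _ _))
    calc ‖stagePoly y₀ h v τ - y₀‖ ≤ |h| * (s * ‖v‖) := norm_stagePoly_sub_le y₀ h v hτ
      _ ≤ |h| * (s * V + 1) := by gcongr; nlinarith [Nat.cast_nonneg (α := ℝ) s]
      _ ≤ r := h1
  -- Assumed is only that the stages stay in the `r`-ball, not `‖v‖ ≤ V`, so that the estimate also
  -- applies to a competing solution in the uniqueness proof.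
  have hcontr : ∀ v w : Fin s → E,
      (∀ τ ∈ Set.Icc (0 : ℝ) 1, ‖stagePoly y₀ h v τ - y₀‖ ≤ r) →
      (∀ τ ∈ Set.Icc (0 : ℝ) 1, ‖stagePoly y₀ h w τ - y₀‖ ≤ r) →
      ‖Ψ v - Ψ w‖ ≤ 1 / 2 * ‖v - w‖ := by
    intro v w hv hw
    have hc : ∀ (v : Fin s → E) (j : Fin s), Continuous fun ζ =>
        g (stagePoly y₀ h v (m.c j)) (stagePoly y₀ h v ζ) := fun v j =>
      hg.continuous.comp (continuous_const.prodMk (continuous_stagePoly y₀ h v))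
    have h1 : Ψ v - Ψ w = m.stageCoeff (fun j ζ =>
        g (stagePoly y₀ h v (m.c j)) (stagePoly y₀ h v ζ) -
        g (stagePoly y₀ h w (m.c j)) (stagePoly y₀ h w ζ)) :=
      funext fun k => m.stageCoeff_sub (hc v) (hc w) k
    have h2 : ‖Ψ v - Ψ w‖ ≤ Λ * (L * (|h| * (s * ‖v - w‖))) := by
      rw [h1]
      refine hΛ _ _ (fun j ζ hζ => ?_) (by positivity)
      have hmem : ∀ u : Fin s → E, (∀ τ ∈ Set.Icc (0 : ℝ) 1, ‖stagePoly y₀ h u τ - y₀‖ ≤ r) →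
          (stagePoly y₀ h u (m.c j), stagePoly y₀ h u ζ) ∈ Metric.closedBall (y₀, y₀) r := by
        intro u hu
        rw [← closedBall_prod_same]
        exact ⟨mem_closedBall_iff_norm.2 (hu _ (m.c_mem j)), mem_closedBall_iff_norm.2 (hu _ hζ)⟩
      refine (hL _ (hmem v hv) _ (hmem w hw)).trans (mul_le_mul_of_nonneg_left ?_ hL0)
      exact max_le (norm_stagePoly_sub_stagePoly_le y₀ h v w (m.c_mem j))
        (norm_stagePoly_sub_stagePoly_le y₀ h v w hζ)
    have h3 : |h| * (2 * (Λ * L * s + 1)) ≤ 1 :=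
      (le_div_iff₀ (by positivity)).1 (hh.trans (min_le_right _ _))
    refine h2.trans ?_
    have h4 : |h| * (Λ * L * s) ≤ 1 / 2 := by linarith [abs_nonneg h]
    calc Λ * (L * (|h| * (s * ‖v - w‖))) = |h| * (Λ * L * s) * ‖v - w‖ := by ring
      _ ≤ 1 / 2 * ‖v - w‖ := by gcongr
  have hmaps : Set.MapsTo Ψ (Metric.closedBall 0 V) (Metric.closedBall 0 V) := by
    intro v hv
    rw [mem_closedBall_zero_iff] at hv ⊢
    exact hV h v (hball v hv)
  have hC : ContractingWith (1 / 2) (hmaps.restrict Ψ _ _) := by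
    refine ⟨by norm_num, LipschitzWith.of_dist_le_mul fun v w => ?_⟩
    rw [Subtype.dist_eq, Subtype.dist_eq, dist_eq_norm, dist_eq_norm]
    exact hcontr v w (hball v (mem_closedBall_zero_iff.1 v.2))
      (hball w (mem_closedBall_zero_iff.1 w.2))
  obtain ⟨v, hv, hfix, -⟩ := hC.exists_fixedPoint' Metric.isClosed_closedBall.isComplete hmaps
    (Metric.mem_closedBall_self hV0) (edist_ne_top _ _)
  refine ⟨v, ⟨fun k => (congrFun hfix k).symm, hball v (mem_closedBall_zero_iff.1 hv)⟩, ?_⟩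
  rintro w ⟨hw, hwr⟩
  have hwfix : Ψ w = w := funext fun k => (hw k).symm
  have h1 := hcontr w v hwr (hball v (mem_closedBall_zero_iff.1 hv))
  rw [hwfix, hfix.eq] at h1
  have h2 : ‖w - v‖ = 0 := le_antisymm (by linarith) (norm_nonneg _)
  exact sub_eq_zero.1 (norm_eq_zero.1 h2)

end PCSRK

/-! ### Order four for Poisson systems and conclusion. -/

theorem IsPoissonSystem.contDiff_toEuclideanCLM {d k : ℕ}
    {S : EuclideanSpace ℝ (Fin d) → Matrix (Fin d) (Fin d) ℝ} {H : EuclideanSpace ℝ (Fin d) → ℝ}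
    (hP : IsPoissonSystem k S H) :
    ContDiff ℝ k (fun z => Matrix.toEuclideanCLM (𝕜 := ℝ) (S z)) := by
  have h1 : (fun z => Matrix.toEuclideanCLM (𝕜 := ℝ) (S z)) = fun z => ∑ i, ∑ j,
      S z i j • Matrix.toEuclideanCLM (𝕜 := ℝ) (Matrix.single i j (1 : ℝ)) := by
    funext z
    conv_lhs => rw [Matrix.matrix_eq_sum_single (S z)]
    simp only [map_sum, ← map_smul, Matrix.smul_single, smul_eq_mul, mul_one]
  rw [h1]
  exact ContDiff.sum fun i _ => ContDiff.sum fun j _ => (hP.contDiff_S i j).smul contDiff_const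

theorem PCSRK.OrderFourConditions.hasOrderAtLeast {m : PCSRK 3} (hm : m.OrderFourConditions) :
    m.HasOrderAtLeast 4 := by
  intro d S H hP y₀ y hy0 hy
  set σ := fun z => Matrix.toEuclideanCLM (𝕜 := ℝ) (S z) with hσdef
  have hσ : ContDiff ℝ 4 σ := hP.contDiff_toEuclideanCLM
  have hν : ContDiff ℝ 4 (∇ H) := hP.contDiff_gradient
  have hg : ContDiff ℝ 4 (Function.uncurry (poissonField S H)) :=
    (hσ.comp contDiff_fst).clm_apply (hν.comp contDiff_snd)
  obtain ⟨h₁, hh₁, hex⟩ := m.existsUnique_isStageSolution (hg.of_le (by norm_num)) y₀ one_pos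
  obtain ⟨V, -, hV⟩ := m.exists_norm_stageCoeff_stagePoly_le hg.continuous y₀ 1
  have hyc : ∀ᶠ t in 𝓝 (0 : ℝ), ‖y t - y₀‖ ≤ 1 := by
    have h1 : ContinuousAt y 0 := hy.self_of_nhds.continuousAt
    have h2 := h1.eventually (Metric.closedBall_mem_nhds (y 0) one_pos)
    simpa [dist_eq_norm, hy0] using h2
  obtain ⟨δ, hδ, hδy⟩ := Metric.nhds_basis_closedBall.eventually_iff.1 (hy.and hyc)
  have hmem : ∀ {h : ℝ}, |h| ≤ δ → ∀ τ ∈ Set.Icc (0 : ℝ) 1, h * τ ∈ Metric.closedBall (0 : ℝ) δ := by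
    intro h hh τ hτ
    rw [mem_closedBall_zero_iff, Real.norm_eq_abs, abs_mul, abs_of_nonneg hτ.1]
    exact (mul_le_of_le_one_right (abs_nonneg h) hτ.2).trans hh
  set h₀ := min h₁ (min 1 δ) with hh₀
  -- The family of all solutions for all admissible `h` is taken as one index type, so that a single
  -- constant `C` serves them all.
  let ι := {x : ℝ × (Fin 3 → EuclideanSpace ℝ (Fin d)) //
    |x.1| ≤ h₀ ∧ m.IsStageSolution (poissonField S H) y₀ 1 x.1 x.2}
  have hι1 : ∀ i : ι, |i.1.1| ≤ 1 := fun i =>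
    i.2.1.trans ((min_le_right _ _).trans (min_le_left _ _))
  have hιδ : ∀ i : ι, |i.1.1| ≤ δ := fun i =>
    i.2.1.trans ((min_le_right _ _).trans (min_le_right _ _))
  obtain ⟨C, hC⟩ := hm.unifBigO_localError (ι := ι) (h := fun i => i.1.1) (v := fun i => i.1.2)
    (σ := σ) (ν := ∇ H) (y₀ := y₀) (r := 1) (y := y) hι1 hσ hν
    (fun k => UnifBigO.of_bound V fun i _ _ => by
      rw [i.2.2.1 k]
      exact (norm_le_pi_norm _ k).trans (hV _ _ i.2.2.2))
    (fun i k => i.2.2.1 k) (fun i => i.2.2.2) hy0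
    (fun i τ hτ => (hδy (hmem (hιδ i) τ hτ)).1) (fun i τ hτ => (hδy (hmem (hιδ i) τ hτ)).2)
  refine ⟨1, one_pos, h₀, by positivity, C, fun h hh => ⟨?_, ?_⟩⟩
  · obtain ⟨v, hv, huniq⟩ := hex h (hh.trans (min_le_left _ _))
    refine ⟨(PCSRK.stagePoly y₀ h v, fun i => PCSRK.stagePoly y₀ h v (m.c i),
      PCSRK.stagePoly y₀ h v 1), ⟨(m.isStep_iff hP).2 ⟨v, rfl, fun _ => rfl, rfl, hv.1⟩, hv.2⟩, ?_⟩
    rintro ⟨Y, Z, y₁⟩ ⟨hs, hYr⟩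
    obtain ⟨w, hY, hZ, h1, hw⟩ := (m.isStep_iff hP).1 hs
    simp only at hY hZ h1 hw hYr
    subst hY
    obtain rfl := huniq w ⟨hw, hYr⟩
    rw [h1, funext hZ]
  · intro Y Z y₁ hs hYr
    obtain ⟨w, hY, hZ, h1, hw⟩ := (m.isStep_iff hP).1 hs
    subst hY
    rw [h1]
    -- The error family is constant in `τ`; `0` is an arbitrary point of `[0, 1]`.
    exact hC ⟨(h, w), hh, hw, hYr⟩ 0 (by simp)

theorem mainTheorem1 (m : PCSRK 3) (α : ℝ)
    (h_symm : ∀ i, (m.M i)ᵀ = m.M i)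
    (h_sum : !![1, 1/2, 1/3; 1/2, 1/3, 1/4; 1/3, 1/4, α] * (m.M 0 + m.M 1 + m.M 2) = 1)
    (h_transf : !![1, 1, 1; 0, -1, -2; 0, 0, 1] * m.M 2 * !![1, 0, 0; 1, -1, 0; 1, -2, 1]
      = m.M 0)
    (h_nodes : m.c 0 + m.c 2 = 1 ∧ m.c 1 = 1/2)
    (h_lin : (m.c 0 • m.M 0 + m.c 1 • m.M 1 + m.c 2 • m.M 2) *ᵥ ![1, 1/2, 1/3] = ![0, 1, 0])
    (h_quad : ![1, 1/2, 1/3] ⬝ᵥ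
      ((m.c 0 ^ 2 • m.M 0 + m.c 1 ^ 2 • m.M 1 + m.c 2 ^ 2 • m.M 2) *ᵥ ![1, 1/2, 1/3]) = 1/3) :
    m.EnergyPreserving ∧ m.Symmetric ∧ m.HasOrderAtLeast 4 := by
  have hM := PCSRK.coeffMatrix_reverse h_sum h_transf
  refine ⟨m.energyPreserving_of_transpose_eq h_symm,
    m.symmetric_of_A_reverse (PCSRK.A_reverse hM) fun j => ?_,
    (PCSRK.orderFourConditions h_symm h_sum hM h_nodes h_lin h_quad).hasOrderAtLeast⟩
  fin_cases j
  · exact eq_sub_of_add_eq' h_nodes.1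
  · change m.c 1 = 1 - m.c 1
    rw [h_nodes.2]
    norm_num
  · exact eq_sub_of_add_eq h_nodes.1
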